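/- **Setting.** Let $n\ge 2$ and let $X_1,\dots,X_n$ be variables with values in $[K]$ whose joint distribution factorizes over an unknown directed tree $D$ (a directed graph whose skeleton is a tree and all of whose edges point away from a root): $P(x)=\prod_i P(x_i\mid x_{\mathrm{Pa}(i)})$. An action is either the empty intervention $\mathrm{do}()$ or a single-node intervention $\mathrm{do}(X=x)$; under $\mathrm{do}(X=x)$ the variables follow the truncated factorization (the factor of $X$ is removed and $X$ is set to $x$). The distribution of the real-valued reward $\mathbf R$ given all variables depends only on the value of one variable $X_R$, unknown to the learner. Write $\mu_a=\mathbb E[\mathbf R\mid a]$; assume $\mu_a\in[0,1]$ for every single-node intervention $a$, and that under every action $a$ (including $\mathrm{do}()$) the noise $\mathbf R-\mu_a$ is $1$-subgaussian. In each round the learner plays an action and observes the values of all variables and the reward; successive outcomes of each action are independent draws from its distribution, and outcomes of different actions are independent. For the actions $a_1,\dots,a_T$ played in $T\ge 1$ rounds the regret is $R_T=T\max_{a}\mu_{a}-\sum_{t\le T}\mu_{a_t}$, the maximum being over the single-node interventions. Let $\varepsilon,\Delta>0$ and assume: * (causal effect identifiability) for every edge $X_i\to X_j$ of $D$ there are values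 $x,x'$ with $|P(X_j=x\mid \mathrm{do}(X_i=x'))-P(X_j=x)|>\varepsilon$; * (reward identifiability) for every ancestor $X$ of $X_R$ ($X_R$ itself included) there is $x\in[K]$ with $|\mathbb E[\mathbf R\mid\mathrm{do}()]-\mathbb E[\mathbf R\mid \mathrm{do}(X=x)]|\ge\Delta$. **Algorithm (CN-UCB).** Given are the skeleton $\mathcal T_0$ of $D$, the observational probabilities $P(X_i=x)$, $K,\Delta,\varepsilon$, $\delta\in(0,1)$, $T$, and $B=\left\lceil\max\left\{\tfrac{32}{\Delta^2}\log\tfrac{8nK}{\delta},\ \tfrac{2}{\varepsilon^2}\log\tfrac{8n^2K^2}{\delta}\right\}\right\rceil$. "Intervening on $X$" means performing $\mathrm{do}(X=z)$ for $B$ times for each $z\in[K]$. The branch of a neighbour $Y$ of $X$ is the set of nodes reachable from $Y$ when the edge $XY$ is cut. A central node of a tree with respect to a distribution on its nodes is a node all of whose branches have weight at most $1/2$; any rule for choosing central nodes is allowed. First perform $\mathrm{do}()$ for $B$ times and let $\hat R$ be the average reward. An intervention on $X$ *shifts the reward* if for some $z$ the average reward under $\mathrm{do}(X=z)$ differs from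 $\hat R$ by more than $\Delta/2$. * *Stage 1.* Start with all nodes as candidates. Repeat: intervene on a central node $v$ of $\mathcal T_0$ for the uniform distribution on the candidates. A neighbour $Y$ of $v$ is "down" if for some $z,y$ the empirical frequency of $Y=y$ under $\mathrm{do}(v=z)$ differs from $P(Y=y)$ by more than $\varepsilon/2$, otherwise "up". If the reward is shifted, go to Stage 2 with the sub-tree $\widetilde{\mathcal T}_0$ obtained by deleting all "up" branches, with root $v$. Otherwise keep as candidates only the previous candidates in the "up" branches. * *Stage 2.* Start with all nodes of $\widetilde{\mathcal T}_0$ as candidates. While there is more than one candidate: intervene on a central node $v$ of $\widetilde{\mathcal T}_0$ for the uniform distribution on the candidates. If the reward is not shifted, keep only the previous candidates in the branch of the parent of $v$. Otherwise intervene on all children of $v$ in $\widetilde{\mathcal T}_0$; if none of them shifts the reward, return $v$; otherwise keep only the previous candidates in the branch of (the last) one that does. When one candidate is left, return it. * *Stage 3.* For the returned node $X$, run UCB on the $K$ actions $\mathrm{do}(X=k)$ in the remaining rounds up to $T$: play an action that has not been played in this stage if there is one, otherwise one that maximizes $\hat\mu_k+\sqrt{2\log(K^2T^2/\delta)/N_k}$,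 where $N_k$ and $\hat\mu_k$ are the number of plays and the average reward in this stage. **Theorem.** There is a universal constant $c>0$ such that, in this setting, for all values of the parameters and every rule for choosing central nodes, with probability at least $1-\delta$ the regret of CN-UCB satisfies $$R_T\le c\left(K\max\left\{\frac1{\Delta^2},\frac1{\varepsilon^2}\right\}d\,(\log n)^2\log\frac K\delta+\sqrt{KT\log\frac{KT}{\delta}}\right),$$ where $d$ is the maximum degree of the skeleton of $D$. In particular $R_T=\widetilde O\big(K\max\{1/\Delta^2,1/\varepsilon^2\}\,d(\log n)^2+\sqrt{KT}\big)$, where $\widetilde O$ ignores poly-logarithmic factors that do not involve $n$. -/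

import Mathlib

open MeasureTheory ProbabilityTheory Finset
open scoped ENNReal

/-! ### Directed trees -/

/-- The undirected graph obtained from a directed graph by forgetting the directions. -/
def skeleton {V : Type} (D : Digraph V) : SimpleGraph V := D.toSimpleGraphInclusive

/-- A directed tree: the skeleton is a tree and, for some root, every edge points away from the
root (in particular there are no directed cycles). -/
def IsDirectedTree {V : Type} (D : Digraph V) : Prop :=
  (skeleton D).IsTree ∧
    ∃ root : V, ∀ u v : V, D.Adj u v →
      (skeleton D).dist root v = (skeleton D).dist root u + 1

open Classical in
/-- The maximum degree of an undirected graph on a finite vertex set. -/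
noncomputable def maxDeg {V : Type} [Fintype V] (T : SimpleGraph V) : ℕ := T.maxDegree

/-! ### Causal bandits -/

/-- Actions: `none` is the empty intervention do(), `some (v, x)` is do(v = x). -/
abbrev Intervention (V : Type) (K : ℕ) : Type := Option (V × Fin K)

/-- What the learner observes in a round: the values of all variables, and the reward. -/
abbrev Outcome (V : Type) (K : ℕ) : Type := (V → Fin K) × ℝ

/-- A causal model over variables `V` with values in `Fin K`, given by a directed graph and the
conditional distribution of every variable given (the values of) its parents, together with a
real-valued reward whose distribution depends only on the value of one variable. -/
structure CausalBandit (V : Type) (K : ℕ) where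
  /-- the causal graph -/
  graph : Digraph V
  /-- conditional distribution of a variable given the values of the other variables -/
  cpd : V → (V → Fin K) → PMF (Fin K)
  /-- only the values of the parents matter -/
  cpd_congr : ∀ (v : V) (x y : V → Fin K),
    (∀ u, graph.Adj u v → x u = y u) → cpd v x = cpd v y
  /-- the reward generating variable -/
  rewardNode : V
  /-- conditional distribution of the reward given the value of the reward generating variable -/
  rewardLaw : Fin K → Measure ℝ
  rewardLaw_prob : ∀ k, IsProbabilityMeasure (rewardLaw k)

namespace CausalBandit

variable {V : Type} [Fintype V] [DecidableEq V] {K : ℕ} (M : CausalBandit V K)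

/-- The joint probability of the configuration `y` of all variables under an action:
the factorization over the graph for do(), and the truncated factorization for do(u = x). -/
noncomputable def jointMass : Intervention V K → (V → Fin K) → ℝ≥0∞
  | none, y => ∏ v, M.cpd v y (y v)
  | some (u, x), y => if y u = x then ∏ v ∈ univ.erase u, M.cpd v y (y v) else 0

/-- The joint distribution of all variables and of the reward under an action. -/
noncomputable def outcomeLaw (a : Intervention V K) : Measure (Outcome V K) :=
  ∑ y : V → Fin K, M.jointMass a y • (M.rewardLaw (y M.rewardNode)).map (fun r => (y, r))

/-- `P(v = y | a)`. -/
noncomputable def prob (a : Intervention V K) (v : V) (y : Fin K) : ℝ :=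
  (M.outcomeLaw a).real {o | o.1 v = y}

/-- The expected reward of an action. -/
noncomputable def meanReward (a : Intervention V K) : ℝ := ∫ o, o.2 ∂(M.outcomeLaw a)

/-- The expected reward of the best single-node intervention. -/
noncomputable def optimalReward : ℝ := ⨆ p : V × Fin K, M.meanReward (some p)

/-- The cumulative regret over `T` rounds, for the sequence of the actions that were played. -/
noncomputable def regret (T : ℕ) (actions : List (Intervention V K)) : ℝ :=
  T * M.optimalReward - (actions.map M.meanReward).sum

/-- The expected rewards of the single-node interventions are in `[0,1]`, and the reward noise
of every action (the empty intervention included) is 1-subgaussian. -/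
def HasBoundedMeansAndSubgaussianNoise : Prop :=
  (∀ p : V × Fin K, M.meanReward (some p) ∈ Set.Icc (0 : ℝ) 1) ∧
  (∀ a : Intervention V K, HasSubgaussianMGF (fun o => o.2 - M.meanReward a) 1 (M.outcomeLaw a))

/-- Causal effect identifiability with gap `ε`. -/
def CausalEffectIdentifiable (ε : ℝ) : Prop :=
  ∀ i j : V, M.graph.Adj i j →
    ∃ x x' : Fin K, ε < |M.prob (some (i, x')) j x - M.prob none j x|

/-- Reward identifiability with gap `Δ`; every variable counts as an ancestor of itself. -/
def RewardIdentifiable (Δ : ℝ) : Prop :=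
  ∀ v : V, Relation.ReflTransGen M.graph.Adj v M.rewardNode →
    ∃ x : Fin K, Δ ≤ |M.meanReward none - M.meanReward (some (v, x))|

end CausalBandit

/-! ### Sequential strategies -/

/-- A (non-anticipating) sequential strategy with actions in `A`, observations in `O` and a final
result in `α`: either stop, or play an action and continue depending on what is observed. -/
inductive Strategy (A O : Type) (α : Type) : Type where
  | done : α → Strategy A O α
  | play : A → (O → Strategy A O α) → Strategy A O α

namespace Strategy

/-- Run a strategy, then another one that may depend on its result. -/
def andThen {A O α β : Type} : Strategy A O α → (α → Strategy A O β) → Strategy A O β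
  | done x, f => f x
  | play a k, f => play a (fun o => (k o).andThen f)

/-- The actions played in the first `T` rounds, when the `i`-th play (from `0`) of the action `a`
yields the observation `Z a i`; `cnt` says how often each action has been played so far. -/
def run {A O α : Type} [DecidableEq A] (Z : A → ℕ → O) :
    ℕ → (A → ℕ) → Strategy A O α → List A
  | 0, _, _ => []
  | _ + 1, _, done _ => []
  | T + 1, cnt, play a k =>
      a :: run Z T (Function.update cnt a (cnt a + 1)) (k (Z a (cnt a)))

/-- Play the action `a` for `B` times and return the observations. -/
def sample {A O : Type} (a : A) : ℕ → Strategy A O (List O)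
  | 0 => done []
  | B + 1 => play a fun o => (sample a B).andThen fun l => done (o :: l)

end Strategy

/-! ### Central nodes -/

section CentralNodes

variable {V : Type} [Fintype V] [DecidableEq V]

/-- The graph on `V` whose edges are the edges of `T` between vertices of `S`. -/
def restrictTo (T : SimpleGraph V) (S : Finset V) : SimpleGraph V where
  Adj u v := T.Adj u v ∧ u ∈ S ∧ v ∈ S
  symm := ⟨fun _ _ h => ⟨h.1.symm, h.2.2, h.2.1⟩⟩
  loopless := ⟨fun _ h => h.1.ne rfl⟩

open Classical in
/-- The branch at `v` of the neighbour `y`, in the part of `T` on the vertices `S`: the nodes that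
can be reached from `y` when the edge between `v` and `y` is cut. -/
noncomputable def branch (T : SimpleGraph V) (S : Finset V) (v y : V) : Finset V :=
  univ.filter fun u => ((restrictTo T S).deleteEdges {s(v, y)}).Reachable y u

/-- `v` is a central node of the part of `T` on the vertices `S`, for the weights `q`. -/
def IsCentralNode (T : SimpleGraph V) (S : Finset V) (q : V → ℝ) (v : V) : Prop :=
  v ∈ S ∧ ∀ y ∈ S, T.Adj v y → ∑ u ∈ branch T S v y, q u ≤ 1 / 2

/-- The uniform distribution on a set of nodes. -/
noncomputable def uniformWeight (C : Finset V) (v : V) : ℝ :=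
  if v ∈ C then 1 / (C.card : ℝ) else 0

/-- A rule for finding central nodes: for every probability distribution on the vertices of the
tree it returns a central node whenever there is one. -/
def IsCentralNodeRule (T : SimpleGraph V) (rule : Finset V → (V → ℝ) → V) : Prop :=
  ∀ (S : Finset V) (q : V → ℝ), (∀ v, 0 ≤ q v) → (∀ v ∉ S, q v = 0) → ∑ v, q v = 1 →
    (∃ v, IsCentralNode T S q v) → IsCentralNode T S q (rule S q)

end CentralNodes

/-! ### The algorithm CN-UCB -/

/-- What the learner is given. -/
structure LearnerInput (V : Type) (K : ℕ) where
  /-- the tree skeleton -/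
  tree : SimpleGraph V
  /-- the observational probabilities `P(v = y)` -/
  obsProb : V → Fin K → ℝ
  /-- reward gap `Δ` -/
  rewardGap : ℝ
  /-- causal effect gap `ε` -/
  effectGap : ℝ
  /-- batch size `B` -/
  batch : ℕ
  /-- allowed failure probability `δ` -/
  failProb : ℝ
  /-- total number of rounds `T` -/
  horizon : ℕ
  /-- the rule for finding central nodes -/
  central : Finset V → (V → ℝ) → V

namespace LearnerInput

variable {V : Type} [Fintype V] [DecidableEq V] {K : ℕ} (I : LearnerInput V K)

/-- Average reward of a list of observations. -/
noncomputable def rewardMean (l : List (Outcome V K)) : ℝ :=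
  (l.map Prod.snd).sum / l.length

/-- Empirical probability of `v = y` in a list of observations. -/
noncomputable def freq (l : List (Outcome V K)) (v : V) (y : Fin K) : ℝ :=
  (l.countP fun o => o.1 v = y) / l.length

/-- Perform do(v = z) for `B` times, for every `z` of a list; returns the data for every `z`. -/
def interveneOn (v : V) :
    List (Fin K) → Strategy (Intervention V K) (Outcome V K) (Fin K → List (Outcome V K))
  | [] => .done fun _ => []
  | z :: zs => (Strategy.sample (some (v, z)) I.batch).andThen fun l =>
      (interveneOn v zs).andThen fun data => .done (Function.update data z l)

/-- Perform do(v = z) for `B` times, for every value `z`. -/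
def intervene (v : V) : Strategy (Intervention V K) (Outcome V K) (Fin K → List (Outcome V K)) :=
  I.interveneOn v (List.finRange K)

/-- The interventional data show an effect on the reward. -/
def RewardShift (Rhat : ℝ) (data : Fin K → List (Outcome V K)) : Prop :=
  ∃ z, |Rhat - rewardMean (data z)| > I.rewardGap / 2

/-- The interventional data show an effect on the variable `y` (which is then "down"). -/
def PointsDown (data : Fin K → List (Outcome V K)) (y : V) : Prop :=
  ∃ z k, |I.obsProb y k - freq (data z) y k| > I.effectGap / 2

open Classical in
/-- The union of the branches of all "up" neighbours of `v`. -/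
noncomputable def upstream (data : Fin K → List (Outcome V K)) (v : V) : Finset V :=
  (univ.filter fun y => I.tree.Adj v y ∧ ¬ I.PointsDown data y).biUnion
    fun y => branch I.tree univ v y

open Classical in
/-- Stage 1. `C` is the set of candidates (the weights are uniform on `C`). Intervene on a central
node `v`; if the reward shifts, return `v` and the vertices of the directed sub-tree with root
`v`; else keep only the candidates in the "up" branches. The first argument bounds the number of
iterations. -/
noncomputable def findSubtree (Rhat : ℝ) :
    ℕ → Finset V → Strategy (Intervention V K) (Outcome V K) (V × Finset V)
  | 0, C => .done (I.central univ (uniformWeight C), univ)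
  | fuel + 1, C =>
      let v := I.central univ (uniformWeight C)
      (I.intervene v).andThen fun data =>
        if I.RewardShift Rhat data then .done (v, univ \ I.upstream data v)
        else findSubtree Rhat fuel (C ∩ I.upstream data v)

open Classical in
/-- The children of `v` in the sub-tree on the vertices `S` with root `r`. -/
noncomputable def children (r : V) (S : Finset V) (v : V) : Finset V :=
  S.filter fun y => I.tree.Adj v y ∧ r ∉ branch I.tree S v y

open Classical in
/-- The branch of the parent of `v` in the sub-tree on the vertices `S` with root `r`
(empty for `v = r`). -/
noncomputable def parentBranch (r : V) (S : Finset V) (v : V) : Finset V :=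
  (S.filter fun y => I.tree.Adj v y ∧ r ∈ branch I.tree S v y).biUnion
    fun y => branch I.tree S v y

open Classical in
/-- Intervene on all nodes of a list, and return the last one whose data show an effect on the
reward, if there is one. -/
noncomputable def findRewardChild (Rhat : ℝ) :
    List V → Strategy (Intervention V K) (Outcome V K) (Option V)
  | [] => .done none
  | y :: ys => (I.intervene y).andThen fun data =>
      (findRewardChild Rhat ys).andThen fun o =>
        .done (o <|> if I.RewardShift Rhat data then some y else none)

open Classical in
/-- Stage 2, on the directed sub-tree with root `r` and vertices `S`. `C` is the set of candidates
(the weights are uniform on `C`). The first numerical argument bounds the number of iterations. -/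
noncomputable def findKeyNode (Rhat : ℝ) (r : V) (S : Finset V) :
    ℕ → Finset V → Strategy (Intervention V K) (Outcome V K) V
  | 0, _ => .done r
  | fuel + 1, C =>
      if C.card ≤ 1 then .done (if h : C.Nonempty then h.choose else r)
      else
        let v := I.central S (uniformWeight C)
        (I.intervene v).andThen fun data =>
          if I.RewardShift Rhat data then
            (I.findRewardChild Rhat (I.children r S v).toList).andThen fun o =>
              match o with
              | none => .done v
              | some y => findKeyNode Rhat r S fuel (C ∩ branch I.tree S v y)
          else findKeyNode Rhat r S fuel (C ∩ I.parentBranch r S v)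

/-- The upper confidence index of an arm with `N` plays of total reward `s`, where `L` is the
logarithm of the inverse confidence level; infinite if the arm has not been played. -/
noncomputable def ucbIndex (L : ℝ) (N : ℕ) (s : ℝ) : EReal :=
  if N = 0 then ⊤ else ((s / N + Real.sqrt (2 * L / N) : ℝ) : EReal)

/-- UCB on the `K` interventions on the node `x`, for the given number of rounds. `N` and `s` are
the numbers of plays and the total rewards of the arms so far. Ties are broken in favour of the
first arm. -/
noncomputable def ucb (x : V) (L : ℝ) :
    ℕ → (Fin K → ℕ) → (Fin K → ℝ) → Strategy (Intervention V K) (Outcome V K) Unit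
  | 0, _, _ => .done ()
  | t + 1, N, s =>
      match (List.finRange K).argmax fun k => ucbIndex L (N k) (s k) with
      | none => .done ()
      | some k => .play (some (x, k)) fun o =>
          ucb x L t (Function.update N k (N k + 1)) (Function.update s k (s k + o.2))

/-- CN-UCB. The UCB stage uses the confidence level `δ / (KT)²`. The horizon bounds the numbers of
iterations and of UCB rounds; this is no restriction in the first `T` rounds, since every iteration
takes at least one round. -/
noncomputable def cnUCB : Strategy (Intervention V K) (Outcome V K) Unit :=
  (Strategy.sample none I.batch).andThen fun l =>
    (I.findSubtree (rewardMean l) I.horizon univ).andThen fun p =>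
      (I.findKeyNode (rewardMean l) p.1 p.2 I.horizon p.2).andThen fun x =>
        ucb x (Real.log (((K : ℝ) * I.horizon) ^ 2 / I.failProb)) I.horizon
          (fun _ => 0) (fun _ => 0)

end LearnerInput

/-- The batch size of CN-UCB for `n` variables with `K` values. -/
noncomputable def batchSize (n K : ℕ) (Δ ε δ : ℝ) : ℕ :=
  ⌈max (32 / Δ ^ 2 * Real.log (8 * n * K / δ))
    (2 / ε ^ 2 * Real.log (8 * (n : ℝ) ^ 2 * (K : ℝ) ^ 2 / δ))⌉₊

/-! The regret bound is deterministic once finitely many empirical averages are accurate. Outcomes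
are indexed by action and play number, so the data of the `j`-th intervention on a node form a fixed
block of `B` plays. Accuracy on all relevant blocks (`IsGoodSample`) therefore follows from
subgaussian tails and a union bound, without any adaptivity argument
(`measure_not_isGoodSample_le`). This only works if few blocks per node can ever be used, so the
revisits of a node must be bounded.

On a good sample every test is correct (`reliableData_of_isGoodSample`). An intervention leaves the
law of every non-descendant unchanged (`prob_do_eq`), so the reward shifts exactly for the ancestors
of the reward node, and a neighbour is "down" exactly if it is a child. In a rooted tree a branch is
either the descendants of a child or the complement of one's own descendants, so each answer places
the reward node in one branch of the central node or ends the stage. A central node has at most half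
of the candidates in each branch, hence `Nat.log 2 n + 1` iterations suffice per stage
(`exec_findSubtree`, `exec_findKeyNode`). All candidates then lie in one branch of a used centre,
which can never be central again in that stage. So a node is intervened on at most three times: once
in Stage 1, once as a centre of Stage 2, and once as the child of such a centre.

The mean reward of any action is an average of the means of the interventions on the reward node
(`meanReward_eq`), so some arm of Stage 3 is globally optimal. Each search round costs at most one,
and the UCB rounds are handled by the usual sum of confidence widths followed by Cauchy-Schwarz
(`exec_ucb`, `sum_range_playCost_le`). For very small horizons the trivial bound `T` on the regret
is enough. -/

set_option linter.unusedSectionVars false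

/-! ### Rooted orientations of trees -/

/-- Every edge increases the depth by one, parents are unique, and every vertex can be reached
from the root. -/
structure IsRootedAt {V : Type} (D : Digraph V) (root : V) (depth : V → ℕ) : Prop where
  depth_eq : ∀ {u v}, D.Adj u v → depth v = depth u + 1
  parent_unique : ∀ {u v w}, D.Adj u w → D.Adj v w → u = v
  reaches : ∀ v, Relation.ReflTransGen D.Adj root v

theorem skeleton_adj_iff {V : Type} (D : Digraph V) (u v : V) :
    (skeleton D).Adj u v ↔ u ≠ v ∧ (D.Adj u v ∨ D.Adj v u) := Iff.rfl

/-- The depth is the distance from the root. A shortest walk to the tail of an edge, extended by the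
edge, is again shortest, hence a path; uniqueness of paths in a tree then makes the tail unique. -/
theorem IsDirectedTree.exists_isRootedAt {V : Type} {D : Digraph V} (h : IsDirectedTree D) :
    ∃ root depth, IsRootedAt D root depth := by
  obtain ⟨hT, root, hr⟩ := h
  have hadj : ∀ {u v}, D.Adj u v → (skeleton D).Adj u v := by
    intro u v huv
    refine ⟨?_, Or.inl huv⟩
    rintro rfl
    have := hr _ _ huv
    omega
  have hpath : ∀ {u v}, D.Adj u v → ∃ p : (skeleton D).Walk root v, p.IsPath ∧
      p.penultimate = u := by
    intro u v huv
    obtain ⟨q, hq⟩ := hT.1.exists_walk_length_eq_dist root u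
    refine ⟨q.concat (hadj huv), ?_, by simp⟩
    apply SimpleGraph.Walk.isPath_of_length_eq_dist
    rw [SimpleGraph.Walk.length_concat, hq, hr _ _ huv]
  refine ⟨root, (skeleton D).dist root, fun {u v} h => hr u v h, ?_, ?_⟩
  · intro u v w hu hv
    obtain ⟨p, hp, rfl⟩ := hpath hu
    obtain ⟨q, hq, rfl⟩ := hpath hv
    rw [(hT.existsUnique_path root w).unique hp hq]
  · intro v
    induction hd : (skeleton D).dist root v generalizing v with
    | zero =>
      rw [(hT.1.dist_eq_zero_iff).1 hd]
    | succ d ih =>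
      obtain ⟨p, hp⟩ := hT.1.exists_walk_length_eq_dist root v
      have hlen : p.length = d + 1 := hp.trans hd
      have hnil : ¬ p.Nil := by
        intro hn
        have := SimpleGraph.Walk.length_eq_zero_iff.2 hn
        omega
      have hA := p.adj_penultimate hnil
      have hle : (skeleton D).dist root p.penultimate ≤ d := by
        have := SimpleGraph.dist_le p.dropLast
        have h2 : p.dropLast.length = p.length - 1 := by simp
        omega
      -- The last edge of a shortest walk must point towards `v`: the opposite orientation would put
      -- its other end farther from the root than `v`.
      rcases hA.2 with h1 | h1
      · have h3 := hr _ _ h1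
        exact (ih p.penultimate (by omega)).tail h1
      · have h3 := hr _ _ h1
        omega

open Classical in
/-- The descendants of a vertex, itself included. -/
noncomputable def descendants {V : Type} [Fintype V] (D : Digraph V) (v : V) : Finset V :=
  univ.filter fun u => Relation.ReflTransGen D.Adj v u

/-! ### Branches of a rooted tree in terms of descendants. -/

section Descendants

variable {V : Type} [Fintype V] [DecidableEq V] {D : Digraph V}

theorem mem_descendants {u v : V} :
    u ∈ descendants D v ↔ Relation.ReflTransGen D.Adj v u := by
  simp [descendants]

theorem self_mem_descendants (v : V) : v ∈ descendants D v :=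
  mem_descendants.2 .refl

theorem descendants_subset {u v : V} (h : u ∈ descendants D v) :
    descendants D u ⊆ descendants D v := fun _ hw =>
  mem_descendants.2 ((mem_descendants.1 h).trans (mem_descendants.1 hw))

variable {root : V} {depth : V → ℕ} (hD : IsRootedAt D root depth)

include hD

theorem IsRootedAt.depth_le {u v : V} (h : Relation.ReflTransGen D.Adj u v) :
    depth u ≤ depth v := by
  induction h with
  | refl => exact le_rfl
  | tail _ h ih => have := hD.depth_eq h; omega

theorem IsRootedAt.descendants_root : descendants D root = univ := by
  ext v
  simp [mem_descendants, hD.reaches v]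

theorem IsRootedAt.skeleton_adj {u v : V} :
    (skeleton D).Adj u v ↔ D.Adj u v ∨ D.Adj v u := by
  rw [skeleton_adj_iff]
  refine ⟨fun h => h.2, fun h => ⟨?_, h⟩⟩
  rintro rfl
  have : D.Adj u u := by tauto
  have := hD.depth_eq this
  omega

theorem IsRootedAt.not_mem_descendants_of_adj {u v : V} (h : D.Adj u v) :
    u ∉ descendants D v := by
  intro hu
  have := hD.depth_le (mem_descendants.1 hu)
  have := hD.depth_eq h
  omega

theorem IsRootedAt.eq_or_parent {a u w : V} (h : w ∈ descendants D a) (hu : D.Adj u w) :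
    w = a ∨ u ∈ descendants D a := by
  rcases Relation.ReflTransGen.cases_tail (mem_descendants.1 h) with h | ⟨b, hb, hbw⟩
  · exact Or.inl h
  · right
    rw [hD.parent_unique hu hbw]
    exact mem_descendants.2 hb

theorem IsRootedAt.exists_parent {r v : V} (hv : v ∈ descendants D r) (hne : v ≠ r) :
    ∃ u ∈ descendants D r, D.Adj u v := by
  rcases Relation.ReflTransGen.cases_tail (mem_descendants.1 hv) with h | ⟨b, hb, hbw⟩
  · exact absurd h hne
  · exact ⟨b, mem_descendants.2 hb, hbw⟩

theorem IsRootedAt.eq_of_mem_of_mem {u v : V} (h : u ∈ descendants D v) (h' : v ∈ descendants D u) :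
    u = v := by
  by_contra hne
  obtain ⟨w, hw, hwu⟩ := hD.exists_parent h hne
  have h1 := hD.depth_eq hwu
  have h2 := hD.depth_le (mem_descendants.1 hw)
  have h3 := hD.depth_le (mem_descendants.1 h')
  omega

omit hD in
theorem reachable_closed {G : SimpleGraph V} {A : Finset V} {a b : V} (ha : a ∈ A)
    (hcl : ∀ x y, x ∈ A → G.Adj x y → y ∈ A) (h : G.Reachable a b) : b ∈ A := by
  obtain ⟨p⟩ := h
  induction p with
  | nil => exact ha
  | cons hadj _ ih => exact ih (hcl _ _ ha hadj)

omit hD in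
theorem mem_branch {T : SimpleGraph V} {S : Finset V} {v y u : V} :
    u ∈ branch T S v y ↔ ((restrictTo T S).deleteEdges {s(v, y)}).Reachable y u := by
  simp [branch]

/-- The only edge leaving the descendants of `y` is the one to the parent of `y`, and that edge is
cut. -/
theorem IsRootedAt.branch_child {r v y : V} (hv : v ∈ descendants D r) (h : D.Adj v y) :
    branch (skeleton D) (descendants D r) v y = descendants D y := by
  have hy : y ∈ descendants D r := mem_descendants.2 ((mem_descendants.1 hv).tail h)
  ext u
  rw [mem_branch]
  constructor
  · refine reachable_closed (self_mem_descendants y) ?_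
    intro a b ha hab
    rw [SimpleGraph.deleteEdges_adj] at hab
    obtain ⟨⟨hab, -, -⟩, hne⟩ := hab
    rcases hD.skeleton_adj.1 hab with hab | hab
    · exact mem_descendants.2 ((mem_descendants.1 ha).tail hab)
    · rcases hD.eq_or_parent ha hab with rfl | h'
      · exact absurd (by rw [hD.parent_unique hab h, Sym2.eq_swap]; rfl) hne
      · exact h'
  · intro hu
    rw [mem_descendants] at hu
    induction hu with
    | refl => exact SimpleGraph.Reachable.refl _
    | @tail a b ha hab ih =>
      refine ih.trans (SimpleGraph.Adj.reachable ?_)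
      have ha' := descendants_subset hy (mem_descendants.2 ha)
      rw [SimpleGraph.deleteEdges_adj]
      refine ⟨⟨hD.skeleton_adj.2 (Or.inl hab), ha', ?_⟩, ?_⟩
      · exact mem_descendants.2 ((mem_descendants.1 ha').tail hab)
      · intro hs
        have h1 := hD.depth_eq h
        have h2 := hD.depth_eq hab
        have h3 := hD.depth_le ha
        rcases Sym2.eq_iff.1 (Set.mem_singleton_iff.1 hs) with ⟨rfl, rfl⟩ | ⟨rfl, rfl⟩ <;> omega

theorem IsRootedAt.branch_parent {r v y : V} (hy : y ∈ descendants D r) (h : D.Adj y v) :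
    branch (skeleton D) (descendants D r) v y = descendants D r \ descendants D v := by
  -- A directed path from `r` to a non-descendant of `v` avoids `v`, so it survives the cut; any two
  -- such vertices are then connected through `r`.
  have key : ∀ u ∈ descendants D r \ descendants D v,
      ((restrictTo (skeleton D) (descendants D r)).deleteEdges {s(v, y)}).Reachable r u := by
    intro u hu
    rw [mem_sdiff] at hu
    obtain ⟨hu, hu'⟩ := hu
    rw [mem_descendants] at hu
    induction hu with
    | refl => exact SimpleGraph.Reachable.refl _
    | @tail a b ha hab ih =>
      have hav : a ∉ descendants D v := fun hav =>
        hu' (mem_descendants.2 ((mem_descendants.1 hav).tail hab))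
      refine (ih hav).trans (SimpleGraph.Adj.reachable ?_)
      rw [SimpleGraph.deleteEdges_adj]
      refine ⟨⟨hD.skeleton_adj.2 (Or.inl hab), mem_descendants.2 ha,
        mem_descendants.2 (ha.tail hab)⟩, ?_⟩
      intro hs
      rcases Sym2.eq_iff.1 (Set.mem_singleton_iff.1 hs) with ⟨rfl, rfl⟩ | ⟨rfl, rfl⟩
      · exact hav (self_mem_descendants _)
      · exact hu' (self_mem_descendants _)
  have hyv : y ∈ descendants D r \ descendants D v :=
    mem_sdiff.2 ⟨hy, hD.not_mem_descendants_of_adj h⟩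
  ext u
  rw [mem_branch]
  constructor
  · refine reachable_closed hyv ?_
    intro a b ha hab
    rw [SimpleGraph.deleteEdges_adj] at hab
    obtain ⟨⟨hab, -, hb⟩, hne⟩ := hab
    rw [mem_sdiff] at ha ⊢
    refine ⟨hb, fun hbv => ?_⟩
    rcases hD.skeleton_adj.1 hab with hab | hab
    · rcases hD.eq_or_parent hbv hab with rfl | h'
      · exact hne (by rw [hD.parent_unique hab h, Sym2.eq_swap]; rfl)
      · exact ha.2 h'
    · exact ha.2 (mem_descendants.2 ((mem_descendants.1 hbv).tail hab))
  · intro hu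
    exact (key y hyv).symm.trans (key u hu)

theorem IsRootedAt.root_mem_branch_parent {r v y : V} (hv : v ∈ descendants D r)
    (hy : y ∈ descendants D r) (h : D.Adj y v) :
    r ∈ branch (skeleton D) (descendants D r) v y := by
  rw [hD.branch_parent hy h, mem_sdiff]
  refine ⟨self_mem_descendants r, fun hr => ?_⟩
  have := hD.eq_of_mem_of_mem hr hv
  subst this
  exact hD.not_mem_descendants_of_adj h hy

theorem IsRootedAt.root_not_mem_branch_child {r v y : V} (hv : v ∈ descendants D r)
    (h : D.Adj v y) : r ∉ branch (skeleton D) (descendants D r) v y := by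
  rw [hD.branch_child hv h]
  exact fun hr => hD.not_mem_descendants_of_adj h (descendants_subset hr hv)

/-- A deepest vertex whose descendants have at least half of the weight is central. -/
theorem IsRootedAt.exists_isCentralNode {r : V} {q : V → ℝ}
    (hq0 : ∀ v ∉ descendants D r, q v = 0) (hq1 : ∑ v, q v = 1) :
    ∃ v, IsCentralNode (skeleton D) (descendants D r) q v := by
  classical
  have hsum : ∑ v ∈ descendants D r, q v = 1 := by
    rw [← hq1]
    exact sum_subset (subset_univ _) fun v _ hv => hq0 v hv
  let H := (descendants D r).filter fun v => 1 / 2 ≤ ∑ u ∈ descendants D v, q u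
  have hH : H.Nonempty := ⟨r, mem_filter.2 ⟨self_mem_descendants r, by rw [hsum]; norm_num⟩⟩
  obtain ⟨v, hv, hmax⟩ := exists_max_image H depth hH
  rw [mem_filter] at hv
  refine ⟨v, hv.1, fun y hy hvy => ?_⟩
  rcases hD.skeleton_adj.1 hvy with h | h
  · rw [hD.branch_child hv.1 h]
    by_contra hlt
    have := hmax y (mem_filter.2 ⟨hy, by linarith⟩)
    have := hD.depth_eq h
    omega
  · rw [hD.branch_parent hy h]
    have := sum_sdiff (f := q) (descendants_subset hv.1)
    have := hv.2
    linarith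

end Descendants

/-! ### Central nodes for uniform weights: halving of the candidates. -/

section UniformWeight

variable {V : Type} [Fintype V] [DecidableEq V]

theorem uniformWeight_nonneg (C : Finset V) (v : V) : 0 ≤ uniformWeight C v := by
  unfold uniformWeight
  split_ifs <;> positivity

theorem sum_uniformWeight (C B : Finset V) :
    ∑ v ∈ B, uniformWeight C v = ((C ∩ B).card : ℝ) / C.card := by
  unfold uniformWeight
  rw [← sum_filter, sum_const, nsmul_eq_mul, filter_mem_eq_inter, inter_comm]
  ring

theorem IsCentralNode.two_mul_card_inter_le {T : SimpleGraph V} {S C : Finset V} {v y : V}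
    (h : IsCentralNode T S (uniformWeight C) v) (hC : C.Nonempty) (hy : y ∈ S)
    (hvy : T.Adj v y) : 2 * (C ∩ branch T S v y).card ≤ C.card := by
  have h1 := h.2 y hy hvy
  rw [sum_uniformWeight, div_le_iff₀ (by exact_mod_cast hC.card_pos)] at h1
  have : (2 * (C ∩ branch T S v y).card : ℝ) ≤ C.card := by linarith
  exact_mod_cast this

/-- This is what prevents a node from being chosen twice as a centre: after its first use the
candidates stay inside one of its branches. -/
theorem IsCentralNode.not_subset_branch {T : SimpleGraph V} {S C : Finset V} {v y : V}
    (h : IsCentralNode T S (uniformWeight C) v) (hC : C.Nonempty) (hy : y ∈ S)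
    (hvy : T.Adj v y) : ¬ C ⊆ branch T S v y := by
  intro hsub
  have h1 := h.two_mul_card_inter_le hC hy hvy
  rw [inter_eq_left.2 hsub] at h1
  have := hC.card_pos
  omega

theorem IsCentralNodeRule.isCentralNode_uniformWeight {D : Digraph V} {root : V} {depth : V → ℕ}
    (hD : IsRootedAt D root depth) {rule : Finset V → (V → ℝ) → V}
    (hrule : IsCentralNodeRule (skeleton D) rule) {r : V} {C : Finset V} (hC : C.Nonempty)
    (hCr : C ⊆ descendants D r) :
    IsCentralNode (skeleton D) (descendants D r) (uniformWeight C)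
      (rule (descendants D r) (uniformWeight C)) := by
  have h0 : ∀ v ∉ descendants D r, uniformWeight C v = 0 := fun v hv => by
    rw [uniformWeight, if_neg fun h => hv (hCr h)]
  have h1 : ∑ v, uniformWeight C v = 1 := by
    rw [sum_uniformWeight, inter_univ, div_self]
    exact_mod_cast hC.card_pos.ne'
  exact hrule _ _ (uniformWeight_nonneg C) h0 h1
    (hD.exists_isCentralNode h0 h1)

end UniformWeight

/-! ### Complete executions of strategies -/

namespace Strategy

variable {A O α β : Type} [DecidableEq A]

/-- Run a strategy to its end: the actions played, the final numbers of plays, and the result. -/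
def exec (Z : A → ℕ → O) : (A → ℕ) → Strategy A O α → List A × (A → ℕ) × α
  | cnt, done x => ([], cnt, x)
  | cnt, play a k =>
      (a :: (exec Z (Function.update cnt a (cnt a + 1)) (k (Z a (cnt a)))).1,
        (exec Z (Function.update cnt a (cnt a + 1)) (k (Z a (cnt a)))).2)

variable {Z : A → ℕ → O}

/-- The stages can thus be analysed without regard to the horizon, and the truncation applied once
at the end. -/
theorem run_eq_take_exec (T : ℕ) (cnt : A → ℕ) (s : Strategy A O α) :
    run Z T cnt s = (exec Z cnt s).1.take T := by
  induction T generalizing cnt s with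
  | zero => simp [run]
  | succ T ih =>
    cases s with
    | done x => simp [run, exec]
    | play a k => simp [run, exec, ih]

theorem exec_andThen (cnt : A → ℕ) (s : Strategy A O α) (f : α → Strategy A O β) :
    exec Z cnt (s.andThen f) =
      ((exec Z cnt s).1 ++ (exec Z (exec Z cnt s).2.1 (f (exec Z cnt s).2.2)).1,
        (exec Z (exec Z cnt s).2.1 (f (exec Z cnt s).2.2)).2) := by
  induction s generalizing cnt with
  | done x => simp [andThen, exec]
  | play a k ih => simp [andThen, exec, ih]

theorem exec_andThen_of_eq {cnt cnt' : A → ℕ} {s : Strategy A O α} {l : List A} {x : α}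
    (h : exec Z cnt s = (l, cnt', x)) (f : α → Strategy A O β) :
    exec Z cnt (s.andThen f) = (l ++ (exec Z cnt' (f x)).1, (exec Z cnt' (f x)).2) := by
  rw [exec_andThen, h]

theorem exec_sample (cnt : A → ℕ) (a : A) (B : ℕ) :
    exec Z cnt (sample a B) =
      (List.replicate B a, Function.update cnt a (cnt a + B),
        (List.range B).map fun i => Z a (cnt a + i)) := by
  induction B generalizing cnt with
  | zero => simp [sample, exec]
  | succ B ih =>
    simp only [sample, exec, exec_andThen, ih, Function.update_self, Function.update_idem]
    refine Prod.ext ?_ (Prod.ext ?_ ?_)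
    · simp [List.replicate_succ]
    · simp only [add_assoc, add_comm 1 B]
    · simp only [List.range_succ_eq_map, List.map_cons, List.map_map, add_zero]
      congr 1
      refine List.map_congr_left fun i _ => ?_
      simp only [Function.comp]
      congr 1
      omega

end Strategy

namespace LearnerInput

open Strategy

variable {V : Type} [Fintype V] [DecidableEq V] {K : ℕ} (I : LearnerInput V K)
  {Z : Intervention V K → ℕ → Outcome V K}

/-- The numbers of plays after `m₀` plays of the empty intervention and `m v` interventions on
every node `v` with batch size `B`. -/
def batchCounts (B m₀ : ℕ) (m : V → ℕ) : Intervention V K → ℕ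
  | none => m₀
  | some (v, _) => B * m v

/-- The data of the `j`-th intervention on `v`. -/
def batchData (Z : Intervention V K → ℕ → Outcome V K) (B : ℕ) (v : V) (j : ℕ) (z : Fin K) :
    List (Outcome V K) :=
  (List.range B).map fun i => Z (some (v, z)) (B * j + i)

theorem exec_interveneOn (v : V) (zs : List (Fin K)) (hzs : zs.Nodup)
    (cnt : Intervention V K → ℕ) :
    (exec Z cnt (I.interveneOn v zs)).1.length = zs.length * I.batch ∧
    (∀ a, (exec Z cnt (I.interveneOn v zs)).2.1 a =
      cnt a + if ∃ z ∈ zs, a = some (v, z) then I.batch else 0) ∧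
    ∀ z ∈ zs, (exec Z cnt (I.interveneOn v zs)).2.2 z =
      (List.range I.batch).map fun i => Z (some (v, z)) (cnt (some (v, z)) + i) := by
  induction zs generalizing cnt with
  | nil => simp [interveneOn, exec]
  | cons z zs ih =>
    rw [List.nodup_cons] at hzs
    obtain ⟨h1, h2, h3⟩ := ih hzs.2
      (Function.update cnt (some (v, z)) (cnt (some (v, z)) + I.batch))
    simp only [interveneOn, exec_andThen, exec_sample, exec, List.append_nil]
    refine ⟨?_, ?_, ?_⟩
    · rw [List.length_append, h1, List.length_replicate, List.length_cons]
      ring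
    · intro a
      rw [h2]
      by_cases ha : a = some (v, z)
      · subst ha
        simp [hzs.1]
      · simp [ha]
    · intro z' hz'
      by_cases hzz : z' = z
      · subst hzz
        simp
      · have hz'' : z' ∈ zs := by simpa [hzz] using hz'
        simp [hzz, h3 z' hz'']

/-- Interventions preserve the shape `batchCounts` of the play counts, so the data seen depend only
on the node and on how often it was visited before. -/
theorem exec_intervene (m₀ : ℕ) (m : V → ℕ) (v : V) :
    ∃ l : List (Intervention V K), l.length = K * I.batch ∧
      exec Z (batchCounts I.batch m₀ m) (I.intervene v) =
        (l, batchCounts I.batch m₀ (Function.update m v (m v + 1)),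
          batchData Z I.batch v (m v)) := by
  obtain ⟨h1, h2, h3⟩ := I.exec_interveneOn (Z := Z) v (List.finRange K) (List.nodup_finRange K)
    (batchCounts I.batch m₀ m)
  refine ⟨(exec Z (batchCounts I.batch m₀ m) (I.interveneOn v (List.finRange K))).1, ?_, ?_⟩
  · simpa using h1
  · refine Prod.ext rfl (Prod.ext ?_ ?_)
    · funext a
      refine (h2 a).trans ?_
      rcases a with _ | ⟨u, z⟩
      · simp [batchCounts]
      · by_cases hu : u = v
        · subst hu
          simp [batchCounts, mul_add]
        · simp [batchCounts, hu]
    · funext z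
      exact h3 z (List.mem_finRange z)

end LearnerInput

/-! ### The search stages on reliable data -/

namespace LearnerInput

open Strategy

variable {V : Type} [Fintype V] [DecidableEq V] {K : ℕ} (I : LearnerInput V K)
  {Z : Intervention V K → ℕ → Outcome V K}

/-- The data of the first three interventions on every node reveal whether it is an ancestor of
`R`, and those of the first one reveal the directions of the edges. -/
structure ReliableData (Z : Intervention V K → ℕ → Outcome V K) (Rhat : ℝ) (D : Digraph V)
    (R : V) : Prop where
  shift_iff : ∀ v, ∀ j < 3,
    (I.RewardShift Rhat (batchData Z I.batch v j) ↔ R ∈ descendants D v)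
  down_iff : ∀ v y, (skeleton D).Adj v y →
    (I.PointsDown (batchData Z I.batch v 0) y ↔ D.Adj v y)

variable {I} {D : Digraph V} {root R : V} {depth : V → ℕ} {Rhat : ℝ}

/-- With correct directions the only "up" neighbour is the parent; for the root there is none and
both sides are empty. -/
theorem upstream_eq (hD : IsRootedAt D root depth) (hT : I.tree = skeleton D)
    (h : I.ReliableData Z Rhat D R) (v : V) :
    I.upstream (batchData Z I.batch v 0) v = univ \ descendants D v := by
  classical
  have hroot := hD.descendants_root
  ext u
  simp only [upstream, hT, mem_biUnion, mem_filter, mem_univ, true_and, mem_sdiff]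
  constructor
  · rintro ⟨y, ⟨hvy, hy⟩, hu⟩
    rw [h.down_iff v y hvy] at hy
    have hyv : D.Adj y v := (hD.skeleton_adj.1 hvy).resolve_left hy
    have := hD.branch_parent (r := root) (hroot ▸ mem_univ y) hyv
    rw [hroot] at this
    rw [this] at hu
    exact (mem_sdiff.1 hu).2
  · intro hu
    have hv : v ∈ descendants D root := hroot ▸ mem_univ v
    obtain ⟨y, hy, hyv⟩ := hD.exists_parent hv fun hv => hu (by rw [hv, hroot]; exact mem_univ u)
    have hvy : (skeleton D).Adj v y := hD.skeleton_adj.2 (Or.inr hyv)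
    refine ⟨y, ⟨hvy, ?_⟩, ?_⟩
    · rw [h.down_iff v y hvy]
      intro hvy'
      have h1 := hD.depth_eq hyv
      have h2 := hD.depth_eq hvy'
      omega
    · have := hD.branch_parent (r := root) hy hyv
      rw [hroot] at this
      rw [this]
      exact mem_sdiff.2 ⟨mem_univ u, hu⟩

/-- The bound `2 ^ i` on the candidates halves in each iteration. The invariant on `m` says that
each used centre has all candidates in one branch. -/
theorem exec_findSubtree (hD : IsRootedAt D root depth) (hT : I.tree = skeleton D)
    (hrule : IsCentralNodeRule (skeleton D) I.central) (h : I.ReliableData Z Rhat D R)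
    (m₀ : ℕ) (fuel : ℕ) :
    ∀ (i : ℕ) (C : Finset V) (m : V → ℕ), i ≤ fuel → C.card < 2 ^ i → R ∈ C →
      (∀ v, m v = 0 ∨ m v = 1 ∧ ∃ y, (skeleton D).Adj v y ∧ C ⊆ branch (skeleton D) univ v y) →
      ∃ (l : List (Intervention V K)) (m' : V → ℕ) (v : V),
        exec Z (batchCounts I.batch m₀ m) (I.findSubtree Rhat fuel C) =
          (l, batchCounts I.batch m₀ m', (v, descendants D v)) ∧
        l.length ≤ i * (K * I.batch) ∧ (∀ u, m' u ≤ 1) ∧ R ∈ descendants D v := by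
  have hroot := hD.descendants_root
  induction fuel with
  | zero =>
    intro i C m hi hC hR
    -- Fewer than `2 ^ 0` candidates contradicts `R ∈ C`, so the default result at zero fuel never
    -- occurs.
    obtain rfl : i = 0 := by omega
    have := card_pos.2 ⟨R, hR⟩
    rw [pow_zero] at hC
    omega
  | succ fuel ih =>
    intro i C m hi hC hR hm
    have hCne : C.Nonempty := ⟨R, hR⟩
    have hcent := hrule.isCentralNode_uniformWeight hD (r := root) (C := C) hCne
      (by rw [hroot]; exact subset_univ C)
    rw [hroot] at hcent
    set v := I.central univ (uniformWeight C) with hv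
    -- The centre is new, so its data are the batch with index 0, the only one for which the edge
    -- directions are guaranteed.
    have hmv : m v = 0 := by
      rcases hm v with h0 | ⟨-, y, hy, hsub⟩
      · exact h0
      · exact absurd hsub (hcent.not_subset_branch hCne (mem_univ y) hy)
    obtain ⟨l, hl, hex⟩ := I.exec_intervene (Z := Z) m₀ m v
    obtain ⟨i, rfl⟩ : ∃ j, i = j + 1 := by
      rcases i with _ | i
      · have := card_pos.2 hCne
        rw [pow_zero] at hC
        omega
      · exact ⟨i, rfl⟩
    rw [findSubtree]
    simp only [← hv]
    rw [exec_andThen_of_eq hex]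
    have hshift := h.shift_iff v (m v) (by omega)
    have hup := upstream_eq hD hT h v
    rw [← hmv] at hup
    rw [hup]
    by_cases hs : R ∈ descendants D v
    · rw [if_pos (hshift.2 hs)]
      refine ⟨l, Function.update m v (m v + 1), v, ?_, ?_, ?_, hs⟩
      · simp [exec]
      · rw [hl, add_mul, one_mul]
        exact Nat.le_add_left _ _
      · intro u
        by_cases hu : u = v
        · simp [hu, hmv]
        · rcases hm u with h0 | ⟨h0, -⟩ <;> simp [hu, h0]
    · rw [if_neg fun h' => hs (hshift.1 h')]
      have hvr : v ≠ root := by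
        intro h'
        rw [h', hroot] at hs
        exact hs (mem_univ R)
      obtain ⟨y, hy, hyv⟩ := hD.exists_parent (hroot ▸ mem_univ v) hvr
      have hvy : (skeleton D).Adj v y := hD.skeleton_adj.2 (Or.inr hyv)
      have hbr := hD.branch_parent (r := root) hy hyv
      rw [hroot] at hbr
      have hcard := hcent.two_mul_card_inter_le hCne (mem_univ y) hvy
      rw [hbr] at hcard
      obtain ⟨l', m', v', hex', hl', hm', hR'⟩ := ih i (C ∩ (univ \ descendants D v))
        (Function.update m v (m v + 1)) (by omega) (by rw [pow_succ] at hC; omega)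
        (mem_inter.2 ⟨hR, mem_sdiff.2 ⟨mem_univ R, hs⟩⟩) (by
          intro u
          by_cases hu : u = v
          · subst hu
            refine Or.inr ⟨by simp [hmv], y, hvy, ?_⟩
            rw [hbr]
            exact inter_subset_right
          · rcases hm u with h0 | ⟨h0, y', hy', hsub⟩
            · exact Or.inl (by simpa [hu] using h0)
            · exact Or.inr ⟨by simpa [hu] using h0, y', hy', inter_subset_left.trans hsub⟩)
      refine ⟨l ++ l', m', v', ?_, ?_, hm', hR'⟩
      · rw [hex']
      · rw [List.length_append, hl, add_mul, one_mul, add_comm]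
        exact Nat.add_le_add_right hl' _

/-- At most two earlier visits means that the batch used here has index below 3, where the data are
reliable. -/
theorem exec_findRewardChild (h : I.ReliableData Z Rhat D R) (m₀ : ℕ) (ys : List V)
    (hys : ys.Nodup) (m : V → ℕ) (hm : ∀ u ∈ ys, m u ≤ 2) :
    ∃ (l : List (Intervention V K)) (o : Option V),
      exec Z (batchCounts I.batch m₀ m) (I.findRewardChild Rhat ys) =
        (l, batchCounts I.batch m₀ (fun u => m u + if u ∈ ys then 1 else 0), o) ∧
      l.length = ys.length * (K * I.batch) ∧
      (∀ y, o = some y → y ∈ ys ∧ R ∈ descendants D y) ∧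
      (o = none → ∀ y ∈ ys, R ∉ descendants D y) := by
  classical
  induction ys generalizing m with
  | nil => exact ⟨[], none, by simp [findRewardChild, exec], by simp, by simp, by simp⟩
  | cons y ys ih =>
    rw [List.nodup_cons] at hys
    obtain ⟨l, hl, hex⟩ := I.exec_intervene (Z := Z) m₀ m y
    obtain ⟨l', o, hex', hl', ho, ho'⟩ := ih hys.2 (Function.update m y (m y + 1)) (by
      intro u hu
      have huy : u ≠ y := fun h' => hys.1 (h' ▸ hu)
      simpa [huy] using hm u (List.mem_cons_of_mem y hu))
    have hiff := h.shift_iff y (m y) (by have := hm y (by simp); omega)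
    have hcnt : (fun u => Function.update m y (m y + 1) u + if u ∈ ys then 1 else 0) =
        fun u => m u + if u ∈ y :: ys then 1 else 0 := by
      funext u
      by_cases huy : u = y
      · subst huy
        simp [hys.1]
      · simp [huy]
    rw [hcnt] at hex'
    refine ⟨l ++ l', o <|> if I.RewardShift Rhat (batchData Z I.batch y (m y)) then some y else none,
      ?_, ?_, ?_, ?_⟩
    · rw [findRewardChild, exec_andThen_of_eq hex, exec_andThen_of_eq hex']
      simp [exec]
    · rw [List.length_append, hl, hl', List.length_cons]
      ring
    · intro w hw
      rcases o with _ | w'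
      · have hw' : (if I.RewardShift Rhat (batchData Z I.batch y (m y)) then some y else none)
          = some w := hw
        split_ifs at hw' with hsh
        cases hw'
        exact ⟨by simp, hiff.1 hsh⟩
      · have hw' : some w' = some w := hw
        have := ho w hw'
        exact ⟨List.mem_cons_of_mem y this.1, this.2⟩
    · intro hn
      rcases o with _ | w'
      · have hn' : (if I.RewardShift Rhat (batchData Z I.batch y (m y)) then some y else none)
          = none := hn
        split_ifs at hn' with hsh
        intro w hw
        rcases List.mem_cons.1 hw with rfl | hw
        · exact fun hR => hsh (hiff.2 hR)
        · exact ho' rfl w hw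
      · exact absurd (show some w' = none from hn) (by simp)

/-- The learner only knows the skeleton and `r`, but `r` lies in the branch of the parent and never
in that of a child. -/
theorem children_eq (hD : IsRootedAt D root depth) (hT : I.tree = skeleton D) {r v : V}
    (hv : v ∈ descendants D r) (y : V) :
    y ∈ I.children r (descendants D r) v ↔ D.Adj v y := by
  simp only [children, hT, mem_filter]
  constructor
  · rintro ⟨hy, hvy, hr⟩
    refine (hD.skeleton_adj.1 hvy).resolve_right fun hyv => hr ?_
    exact hD.root_mem_branch_parent hv hy hyv
  · intro h
    exact ⟨mem_descendants.2 ((mem_descendants.1 hv).tail h), hD.skeleton_adj.2 (Or.inl h),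
      hD.root_not_mem_branch_child hv h⟩

theorem parentBranch_eq (hD : IsRootedAt D root depth) (hT : I.tree = skeleton D) {r v y : V}
    (hv : v ∈ descendants D r) (hy : y ∈ descendants D r) (h : D.Adj y v) :
    I.parentBranch r (descendants D r) v = branch (skeleton D) (descendants D r) v y := by
  ext u
  simp only [parentBranch, hT, mem_biUnion, mem_filter]
  constructor
  · rintro ⟨w, ⟨hw, hvw, hr⟩, hu⟩
    rcases hD.skeleton_adj.1 hvw with hvw | hwv
    · exact absurd hr (hD.root_not_mem_branch_child hv hvw)
    · rwa [hD.parent_unique h hwv]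
  · intro hu
    exact ⟨y, ⟨hy, hD.skeleton_adj.2 (Or.inr h), hD.root_mem_branch_parent hv hy h⟩, hu⟩

/-- All the candidates are in one branch of `v`. -/
def Excluded (D : Digraph V) (S C : Finset V) (v : V) : Prop :=
  ∃ y ∈ S, (skeleton D).Adj v y ∧ C ⊆ branch (skeleton D) S v y

theorem Excluded.mono {S C C' : Finset V} {v : V} (h : Excluded D S C v) (hC : C' ⊆ C) :
    Excluded D S C' v := by
  obtain ⟨y, hy, hvy, hsub⟩ := h
  exact ⟨y, hy, hvy, hC.trans hsub⟩

open Classical in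
/-- A bound on the number of interventions on `u` before the candidates are `C`. -/
noncomputable def visitBound (D : Digraph V) (S C : Finset V) (u : V) : ℕ :=
  1 + (if Excluded D S C u then 1 else 0) +
    if ∃ p, D.Adj p u ∧ Excluded D S C p then 1 else 0

theorem visitBound_le (S C : Finset V) (u : V) : visitBound D S C u ≤ 3 := by
  unfold visitBound
  split_ifs <;> omega

theorem ite_one_zero_mono {p q : Prop} [Decidable p] [Decidable q] (h : p → q) :
    (if p then 1 else 0) ≤ if q then 1 else 0 := by
  by_cases hp : p
  · simp [hp, h hp]
  · simp [hp]

open Classical in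
theorem visitBound_mono {S C C' : Finset V} (hC : C' ⊆ C) (u : V) :
    visitBound D S C u ≤ visitBound D S C' u :=
  Nat.add_le_add (Nat.add_le_add_left (ite_one_zero_mono fun h => h.mono hC) _)
    (ite_one_zero_mono fun ⟨p, hp, h⟩ => ⟨p, hp, h.mono hC⟩)

-- Using `v` as a centre raises the bound of `v`, which becomes excluded, and of every child of `v`,
-- whose only parent becomes excluded. This pays for the interventions of one iteration.
open Classical in
theorem visitBound_add_le (hD : IsRootedAt D root depth) {S C C' : Finset V} (hC : C' ⊆ C) {v : V}
    (hv : ¬ Excluded D S C v) (hv' : Excluded D S C' v) (u : V) :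
    visitBound D S C u + (if u = v then 1 else 0) + (if D.Adj v u then 1 else 0) ≤
      visitBound D S C' u := by
  have h1 := ite_one_zero_mono fun h : Excluded D S C u => h.mono hC
  have h2 : (if ∃ p, D.Adj p u ∧ Excluded D S C p then 1 else 0) ≤
      if ∃ p, D.Adj p u ∧ Excluded D S C' p then 1 else 0 :=
    ite_one_zero_mono fun ⟨p, hp, h⟩ => ⟨p, hp, h.mono hC⟩
  by_cases huv : u = v
  · subst huv
    have hn : ¬ D.Adj u u := fun h => by have := hD.depth_eq h; omega
    simp only [visitBound, if_neg hv, if_pos hv', if_neg hn, if_true]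
    omega
  · rw [if_neg huv]
    by_cases ha : D.Adj v u
    · have h3 : ¬ ∃ p, D.Adj p u ∧ Excluded D S C p := by
        rintro ⟨p, hp, h⟩
        rw [hD.parent_unique hp ha] at h
        exact hv h
      have h4 : ∃ p, D.Adj p u ∧ Excluded D S C' p := ⟨v, ha, hv'⟩
      simp only [visitBound, if_neg h3, if_pos h4, if_pos ha]
      omega
    · rw [if_neg ha]
      exact visitBound_mono hC u

/-- A centre and its children have one of the three units still unspent, so their next batch has
index below 3. -/
theorem visitBound_le_two (hD : IsRootedAt D root depth) {S C : Finset V} {v : V}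
    (hv : ¬ Excluded D S C v) {u : V} (hu : u = v ∨ D.Adj v u) : visitBound D S C u ≤ 2 := by
  unfold visitBound
  rcases hu with rfl | hu
  · rw [if_neg hv]
    split_ifs <;> omega
  · rw [if_neg (c := ∃ p, D.Adj p u ∧ Excluded D S C p)]
    · split_ifs <;> omega
    · rintro ⟨p, hp, h⟩
      rw [hD.parent_unique hp hu] at h
      exact hv h

/-- An iteration costs at most `1 + d` interventions and halves the candidates, and `visitBound`
controls the revisits. If the centre is an ancestor of `R` and no child is, the centre is `R`. -/
theorem exec_findKeyNode (hD : IsRootedAt D root depth) (hT : I.tree = skeleton D)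
    (hrule : IsCentralNodeRule (skeleton D) I.central) (h : I.ReliableData Z Rhat D R) {d : ℕ}
    (hd : ∀ v, ∀ s : Finset V, (∀ y ∈ s, D.Adj v y) → s.card ≤ d)
    (m₀ : ℕ) {r : V} (hr : R ∈ descendants D r) (fuel : ℕ) :
    ∀ (i : ℕ) (C : Finset V) (m : V → ℕ), i ≤ fuel → C.card < 2 ^ i → R ∈ C →
      C ⊆ descendants D r → (∀ u, m u ≤ visitBound D (descendants D r) C u) →
      ∃ (l : List (Intervention V K)) (m' : V → ℕ),
        exec Z (batchCounts I.batch m₀ m) (I.findKeyNode Rhat r (descendants D r) fuel C) =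
          (l, batchCounts I.batch m₀ m', R) ∧
        l.length ≤ i * ((1 + d) * (K * I.batch)) ∧ ∀ u, m' u ≤ 3 := by
  classical
  induction fuel with
  | zero =>
    intro i C m hi hC hR
    obtain rfl : i = 0 := by omega
    have := card_pos.2 ⟨R, hR⟩
    rw [pow_zero] at hC
    omega
  | succ fuel ih =>
    intro i C m hi hC hR hCr hm
    have hCne : C.Nonempty := ⟨R, hR⟩
    rw [findKeyNode]
    split_ifs with hcard1
    · refine ⟨[], m, ?_, by simp, fun u => (hm u).trans (visitBound_le _ _ u)⟩
      exact Prod.ext rfl (Prod.ext rfl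
        (card_le_one.1 hcard1 _ (Exists.choose_spec hCne) _ hR))
    · have hcent := hrule.isCentralNode_uniformWeight hD hCne hCr
      set v := I.central (descendants D r) (uniformWeight C) with hv
      have hvr : v ∈ descendants D r := hcent.1
      have hnx : ¬ Excluded D (descendants D r) C v := by
        rintro ⟨y, hy, hvy, hsub⟩
        exact hcent.not_subset_branch hCne hy hvy hsub
      have hmv : m v ≤ 2 := (hm v).trans (visitBound_le_two hD hnx (Or.inl rfl))
      obtain ⟨l, hl, hex⟩ := I.exec_intervene (Z := Z) m₀ m v
      have hshift := h.shift_iff v (m v) (by omega)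
      obtain ⟨i, rfl⟩ : ∃ j, i = j + 1 := by
        rcases i with _ | i
        · have := card_pos.2 hCne
          rw [pow_zero] at hC
          omega
        · exact ⟨i, rfl⟩
      rw [pow_succ] at hC
      dsimp only
      rw [exec_andThen_of_eq hex]
      by_cases hs : R ∈ descendants D v
      · simp only [if_pos (hshift.2 hs)]
        have hch := children_eq (I := I) hD hT hvr
        have hlen : (I.children r (descendants D r) v).toList.length ≤ d := by
          rw [length_toList]
          exact hd v _ fun y hy => (hch y).1 hy
        obtain ⟨l', o, hex', hl', ho, ho'⟩ := exec_findRewardChild h m₀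
          (I.children r (descendants D r) v).toList (nodup_toList _)
          (Function.update m v (m v + 1)) (by
            intro u hu
            rw [mem_toList, hch] at hu
            have huv : u ≠ v := by
              rintro rfl
              have := hD.depth_eq hu
              omega
            simpa [huv] using (hm u).trans (visitBound_le_two hD hnx (Or.inr hu)))
        have hcnt : (fun u => Function.update m v (m v + 1) u +
            if u ∈ (I.children r (descendants D r) v).toList then 1 else 0) =
            fun u => m u + (if u = v then 1 else 0) + if D.Adj v u then 1 else 0 := by
          funext u
          simp only [mem_toList, hch]
          by_cases huv : u = v
          · subst huv
            simp
          · simp [huv]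
        rw [hcnt] at hex'
        rw [exec_andThen_of_eq hex']
        have hll : (l ++ l').length ≤ (1 + d) * (K * I.batch) := by
          rw [List.length_append, hl, hl', add_mul, one_mul]
          exact Nat.add_le_add_left (Nat.mul_le_mul_right _ hlen) _
        rcases o with _ | y
        · have hRv : R = v := by
            by_contra hne
            rcases Relation.ReflTransGen.cases_head (mem_descendants.1 hs) with h' | ⟨w, hw, hwR⟩
            · exact hne h'.symm
            · exact ho' rfl w (mem_toList.2 ((hch w).2 hw)) (mem_descendants.2 hwR)
          refine ⟨l ++ l', fun u => m u + (if u = v then 1 else 0) + if D.Adj v u then 1 else 0,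
            ?_, ?_, ?_⟩
          · simp [exec, hRv]
          · refine hll.trans ?_
            rw [add_mul i, one_mul]
            exact Nat.le_add_left _ _
          · intro u
            have h3 := (hm u).trans (visitBound_le _ _ u)
            have h4 : u = v ∨ D.Adj v u → m u ≤ 2 := fun h' =>
              (hm u).trans (visitBound_le_two hD hnx h')
            have h5 : u = v → ¬ D.Adj v u := by
              rintro rfl h'
              have := hD.depth_eq h'
              omega
            dsimp only
            -- The increments exclude each other, as `v` is not its own child, and where one applies
            -- the count was at most two.
            split_ifs <;> first | omega | (exfalso; tauto) | (have := h4 (by tauto); omega)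
        · obtain ⟨hy, hRy⟩ := ho y rfl
          rw [mem_toList, hch] at hy
          have hyr : y ∈ descendants D r :=
            mem_descendants.2 ((mem_descendants.1 hvr).tail hy)
          have hvy : (skeleton D).Adj v y := hD.skeleton_adj.2 (Or.inl hy)
          have hhalf := hcent.two_mul_card_inter_le hCne hyr hvy
          have hx : Excluded D (descendants D r) (C ∩ branch (skeleton D) (descendants D r) v y) v :=
            ⟨y, hyr, hvy, inter_subset_right⟩
          obtain ⟨l'', m', hex'', hl'', hm'⟩ := ih i
            (C ∩ branch (skeleton D) (descendants D r) v y)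
            (fun u => m u + (if u = v then 1 else 0) + if D.Adj v u then 1 else 0)
            (by omega) (by omega)
            (mem_inter.2 ⟨hR, by rw [hD.branch_child hvr hy]; exact hRy⟩)
            (inter_subset_left.trans hCr) (by
              intro u
              have h6 := visitBound_add_le hD inter_subset_left hnx hx u
              have := hm u
              omega)
          refine ⟨l ++ (l' ++ l''), m', ?_, ?_, hm'⟩
          · rw [hT]
            simp only [hex'']
          · rw [← List.append_assoc, List.length_append, add_mul i, one_mul, add_comm]
            exact Nat.add_le_add hl'' hll
      · simp only [if_neg fun h' => hs (hshift.1 h')]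
        have hne : v ≠ r := by
          intro h'
          rw [h'] at hs
          exact hs hr
        obtain ⟨y, hy, hyv⟩ := hD.exists_parent hvr hne
        have hvy : (skeleton D).Adj v y := hD.skeleton_adj.2 (Or.inr hyv)
        have hhalf := hcent.two_mul_card_inter_le hCne hy hvy
        have hx : Excluded D (descendants D r) (C ∩ branch (skeleton D) (descendants D r) v y) v :=
          ⟨y, hy, hvy, inter_subset_right⟩
        obtain ⟨l'', m', hex'', hl'', hm'⟩ := ih i
          (C ∩ branch (skeleton D) (descendants D r) v y) (Function.update m v (m v + 1))
          (by omega) (by omega)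
          (mem_inter.2 ⟨hR, by rw [hD.branch_parent hy hyv]; exact mem_sdiff.2 ⟨hCr hR, hs⟩⟩)
          (inter_subset_left.trans hCr) (by
            intro u
            have h6 := visitBound_add_le hD inter_subset_left hnx hx u
            have := hm u
            by_cases huv : u = v
            · subst huv
              simp only [Function.update_self]
              simp only [if_true] at h6
              omega
            · simp only [ne_eq, huv, not_false_eq_true, Function.update_of_ne]
              omega)
        refine ⟨l ++ l'', m', ?_, ?_, hm'⟩
        · rw [parentBranch_eq hD hT hvr hy hyv]
          simp only [hex'']
        · rw [List.length_append, add_mul i, one_mul, add_comm]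
          refine Nat.add_le_add hl'' ?_
          rw [hl, add_mul, one_mul]
          exact Nat.le_add_right _ _

end LearnerInput

/-! ### Interventional distributions -/

section Marginals

variable {V : Type} [Fintype V] [DecidableEq V] {K : ℕ}

/-- Exchanging the value at `u` with the spare value `x` is an involution of the pairs, so
resampling one coordinate only counts every configuration `K` times. -/
theorem sum_sum_update (u : V) (g : (V → Fin K) → ℝ≥0∞) :
    ∑ y, ∑ x, g (Function.update y u x) = K * ∑ y, g y := by
  have hinv : Function.Involutive fun p : (V → Fin K) × Fin K =>
      (Function.update p.1 u p.2, p.1 u) := by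
    rintro ⟨y, x⟩
    simp
  have hsum : ∑ p : (V → Fin K) × Fin K, g (Function.update p.1 u p.2) =
      ∑ p : (V → Fin K) × Fin K, g p.1 :=
    Equiv.sum_comp hinv.toPerm fun p : (V → Fin K) × Fin K => g p.1
  rw [← Fintype.sum_prod_type' (f := fun y x => g (Function.update y u x)), hsum,
    Fintype.sum_prod_type]
  simp [mul_sum]

/-- Summing out a variable of which the other factors do not depend. -/
theorem card_mul_sum_mul_pmf (u : V) {h : (V → Fin K) → ℝ≥0∞} {q : (V → Fin K) → PMF (Fin K)}
    (hh : ∀ y x, h (Function.update y u x) = h y) (hq : ∀ y x, q (Function.update y u x) = q y) :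
    K * ∑ y, h y * q y (y u) = ∑ y, h y := by
  rw [← sum_sum_update u]
  refine sum_congr rfl fun y _ => ?_
  simp only [hh, hq, Function.update_self]
  have hone : ∑ x, q y x = 1 := by
    rw [← (q y).tsum_coe, tsum_fintype]
  rw [← mul_sum, hone, mul_one]

/-- Summing out a set of variables that is closed under taking children. -/
theorem pow_card_mul_sum_mul_prod {D : Digraph V} {root : V} {depth : V → ℕ}
    (hD : IsRootedAt D root depth) {c : V → (V → Fin K) → PMF (Fin K)}
    (hc : ∀ v x y, (∀ u, D.Adj u v → x u = y u) → c v x = c v y)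
    {f : (V → Fin K) → ℝ≥0∞} (W : Finset V) (hW : ∀ u ∈ W, ∀ t, D.Adj u t → t ∈ W)
    (hf : ∀ u ∈ W, ∀ y x, f (Function.update y u x) = f y) :
    (K : ℝ≥0∞) ^ W.card * ∑ y, f y * ∏ v, c v y (y v) =
      ∑ y, f y * ∏ v ∈ Wᶜ, c v y (y v) := by
  induction hn : W.card generalizing W with
  | zero =>
    rw [card_eq_zero] at hn
    subst hn
    simp
  | succ n ih =>
    have hne : W.Nonempty := card_pos.1 (by omega)
    -- A vertex of least depth is a child of no member of `W`, so removing it leaves a set closed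
    -- under children. That set is summed out by induction, and `u` after it.
    obtain ⟨u, hu, hmin⟩ := exists_min_image W depth hne
    have hcompl : (W.erase u)ᶜ = insert u Wᶜ := by
      ext t
      simp only [mem_compl, mem_erase, mem_insert]
      tauto
    have hIH := ih (W.erase u)
      (by
        intro w hw t ht
        rw [mem_erase] at hw ⊢
        refine ⟨?_, hW w hw.2 t ht⟩
        rintro rfl
        have := hmin w hw.2
        have := hD.depth_eq ht
        omega)
      (fun w hw => hf w (mem_of_mem_erase hw)) (by rw [card_erase_of_mem hu]; omega)
    rw [pow_succ, mul_comm ((K : ℝ≥0∞) ^ n), mul_assoc, hIH, hcompl]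
    rw [← card_mul_sum_mul_pmf (K := K) u (h := fun y => f y * ∏ v ∈ Wᶜ, c v y (y v)) (q := c u)]
    · congr 1
      refine sum_congr rfl fun y _ => ?_
      rw [prod_insert (by simpa using hu)]
      ring
    · intro y x
      rw [hf u hu]
      congr 1
      refine prod_congr rfl fun t ht => ?_
      rw [mem_compl] at ht
      have htu : t ≠ u := fun h' => ht (h' ▸ hu)
      rw [Function.update_of_ne htu, hc t (Function.update y u x) y]
      intro s hs
      refine Function.update_of_ne ?_ _ _
      rintro rfl
      exact ht (hW s hu t hs)
    · intro y x
      refine hc u _ _ fun s hs => Function.update_of_ne ?_ _ _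
      rintro rfl
      have := hD.depth_eq hs
      omega

end Marginals

namespace CausalBandit

variable {V : Type} [Fintype V] [DecidableEq V] {K : ℕ} (M : CausalBandit V K)

/-- The conditional distribution of a variable given its parents under an action. -/
noncomputable def localLaw (a : Intervention V K) (u : V) (y : V → Fin K) : PMF (Fin K) :=
  match a with
  | none => M.cpd u y
  | some (v, x) => if u = v then PMF.pure x else M.cpd u y

/-- Replacing the removed factor by a point mass turns the truncated factorization into an ordinary
one, so that all actions can be treated alike. -/
theorem jointMass_eq_prod (a : Intervention V K) (y : V → Fin K) :
    M.jointMass a y = ∏ u, M.localLaw a u y (y u) := by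
  rcases a with _ | ⟨v, x⟩
  · rfl
  · rw [← mul_prod_erase univ _ (mem_univ v)]
    have h : ∀ u ∈ univ.erase v, M.localLaw (some (v, x)) u y (y u) = M.cpd u y (y u) := by
      intro u hu
      simp [localLaw, (mem_erase.1 hu).1]
    rw [prod_congr rfl h]
    simp [jointMass, localLaw, PMF.pure_apply]

theorem jointMass_le_one (a : Intervention V K) (y : V → Fin K) : M.jointMass a y ≤ 1 := by
  rw [jointMass_eq_prod]
  exact prod_le_one' fun u _ => PMF.coe_le_one _ _

theorem jointMass_ne_top (a : Intervention V K) (y : V → Fin K) : M.jointMass a y ≠ ∞ :=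
  ((M.jointMass_le_one a y).trans_lt ENNReal.one_lt_top).ne

theorem measurable_pair (y : V → Fin K) : Measurable fun r : ℝ => ((y, r) : Outcome V K) :=
  measurable_prodMk_left

theorem outcomeLaw_apply_preimage_fst (a : Intervention V K) (s : Set (V → Fin K)) :
    M.outcomeLaw a (Prod.fst ⁻¹' s) = ∑ y, s.indicator (M.jointMass a) y := by
  classical
  have hs : MeasurableSet (Prod.fst ⁻¹' s : Set (Outcome V K)) :=
    measurable_fst (Set.toFinite s).measurableSet
  rw [outcomeLaw, Measure.finsetSum_apply]
  refine sum_congr rfl fun y _ => ?_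
  have := M.rewardLaw_prob (y M.rewardNode)
  rw [Measure.smul_apply, Measure.map_apply (measurable_pair y) hs, smul_eq_mul]
  by_cases hy : y ∈ s
  · simp [hy, Set.preimage_preimage]
  · simp [hy, Set.preimage_preimage]

theorem prob_eq_sum (a : Intervention V K) (v : V) (k : Fin K) :
    M.prob a v k = ∑ y, if y v = k then (M.jointMass a y).toReal else 0 := by
  have h := M.outcomeLaw_apply_preimage_fst a {y | y v = k}
  rw [prob, measureReal_def]
  refine (congrArg ENNReal.toReal h).trans ?_
  rw [ENNReal.toReal_sum]
  · refine sum_congr rfl fun y _ => ?_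
    by_cases hy : y v = k <;> simp [hy]
  · intro y _
    by_cases hy : y v = k <;> simp [hy, M.jointMass_ne_top]

theorem sum_jointMass_toReal (a : Intervention V K) [IsProbabilityMeasure (M.outcomeLaw a)] :
    ∑ y, (M.jointMass a y).toReal = 1 := by
  have h := M.outcomeLaw_apply_preimage_fst a Set.univ
  rw [Set.preimage_univ, measure_univ] at h
  rw [← ENNReal.toReal_sum fun y _ => M.jointMass_ne_top a y]
  simpa using congrArg ENNReal.toReal h.symm

theorem sum_prob (a : Intervention V K) [IsProbabilityMeasure (M.outcomeLaw a)] (v : V) :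
    ∑ k, M.prob a v k = 1 := by
  simp only [prob_eq_sum]
  rw [sum_comm]
  simp [M.sum_jointMass_toReal a]

theorem prob_nonneg (a : Intervention V K) (v : V) (k : Fin K) : 0 ≤ M.prob a v k :=
  measureReal_nonneg

/-- Other values have no mass by truncation, so `k` carries the total mass one. -/
theorem prob_do_self (v : V) (k : Fin K) [IsProbabilityMeasure (M.outcomeLaw (some (v, k)))] :
    ∀ j, M.prob (some (v, k)) v j = if j = k then 1 else 0 := by
  have h0 : ∀ j, j ≠ k → M.prob (some (v, k)) v j = 0 := by
    intro j hj
    rw [prob_eq_sum]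
    refine sum_eq_zero fun y _ => ?_
    split_ifs with hy
    · simp [jointMass, hy, hj]
    · rfl
  intro j
  split_ifs with hj
  · have := M.sum_prob (some (v, k)) v
    rw [sum_eq_single k (fun j _ hj => h0 j hj) (by simp)] at this
    rw [hj, this]
  · exact h0 j hj

/-- An intervention does not change the distribution of a variable that is not a descendant. -/
theorem prob_do_eq {root : V} {depth : V → ℕ} (hD : IsRootedAt M.graph root depth) {v w : V}
    (hw : w ∉ descendants M.graph v) (x k : Fin K) :
    M.prob (some (v, x)) w k = M.prob none w k := by
  classical
  -- The non-ancestors of `w` are closed under children and contain `v`. Summing them out leaves the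
  -- same product with and without the intervention.
  let W : Finset V := univ.filter fun u => w ∉ descendants M.graph u
  have hW : ∀ u ∈ W, ∀ t, M.graph.Adj u t → t ∈ W := by
    intro u hu t ht
    simp only [W, mem_filter, mem_univ, true_and] at hu ⊢
    exact fun h => hu (descendants_subset (mem_descendants.2 (.single ht)) h)
  have hwW : w ∉ W := by simp [W, self_mem_descendants]
  have hvW : v ∈ W := by simp [W, hw]
  let f : (V → Fin K) → ℝ≥0∞ := fun y => if y w = k then 1 else 0
  have hf : ∀ u ∈ W, ∀ y x, f (Function.update y u x) = f y := by
    intro u hu y x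
    have : w ≠ u := fun h => hwW (h ▸ hu)
    simp [f, this]
  have hcongr : ∀ a : Intervention V K, ∀ u x y, (∀ t, M.graph.Adj t u → x t = y t) →
      M.localLaw a u x = M.localLaw a u y := by
    rintro (_ | ⟨v', x'⟩) u x y h
    · exact M.cpd_congr u x y h
    · simp only [localLaw, M.cpd_congr u x y h]
  have h1 := pow_card_mul_sum_mul_prod hD (hcongr (some (v, x))) W hW hf
  have h2 := pow_card_mul_sum_mul_prod hD (hcongr none) W hW hf
  have h3 : ∀ y, ∏ u ∈ Wᶜ, M.localLaw (some (v, x)) u y (y u) =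
      ∏ u ∈ Wᶜ, M.localLaw none u y (y u) := by
    intro y
    refine prod_congr rfl fun u hu => ?_
    have : u ≠ v := fun h => (mem_compl.1 hu) (h ▸ hvW)
    simp [localLaw, this]
  simp only [h3] at h1
  rw [← h2] at h1
  have hK : (K : ℝ≥0∞) ≠ 0 := by
    have : K ≠ 0 := by rintro rfl; exact k.elim0
    exact_mod_cast this
  have h4 := (ENNReal.mul_right_inj (pow_ne_zero _ hK)
    (ENNReal.pow_ne_top (ENNReal.natCast_ne_top K))).1 h1
  have h5 : ∀ a, M.prob a w k = (∑ y, f y * ∏ u, M.localLaw a u y (y u)).toReal := by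
    intro a
    rw [prob_eq_sum, ENNReal.toReal_sum]
    · refine sum_congr rfl fun y _ => ?_
      rw [← jointMass_eq_prod]
      by_cases hy : y w = k <;> simp [f, hy]
    · intro y _
      rw [← jointMass_eq_prod]
      by_cases hy : y w = k <;> simp [f, hy, M.jointMass_ne_top]
  rw [h5, h5, h4]

/-- The expected reward given the value of the reward generating variable. -/
noncomputable def conditionalMean (k : Fin K) : ℝ := ∫ r, r ∂M.rewardLaw k

variable {M}

/-! ### Mean rewards of the actions and their gaps. -/

section Means

variable [hP : ∀ a, IsProbabilityMeasure (M.outcomeLaw a)]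
  (hM : M.HasBoundedMeansAndSubgaussianNoise)

include hM

theorem HasBoundedMeansAndSubgaussianNoise.integrable (a : Intervention V K) :
    Integrable (fun o => o.2) (M.outcomeLaw a) := by
  have h := ((hM.2 a).integrable).add (integrable_const (M.meanReward a))
  refine h.congr (Filter.Eventually.of_forall fun o => ?_)
  simp

/-- An action affects the reward only through the law of the reward node. With
`meanReward_do_rewardNode` this makes every mean a convex combination of the means of interventions
on that node. -/
theorem HasBoundedMeansAndSubgaussianNoise.meanReward_eq (a : Intervention V K) :
    M.meanReward a = ∑ k, M.prob a M.rewardNode k * M.conditionalMean k := by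
  have hint := hM.integrable a
  rw [outcomeLaw, integrable_finsetSum_measure] at hint
  rw [meanReward, outcomeLaw, integral_finsetSum_measure hint]
  have h1 : ∀ y : V → Fin K, ∫ o, o.2 ∂(M.jointMass a y •
      (M.rewardLaw (y M.rewardNode)).map fun r => ((y, r) : Outcome V K)) =
      (M.jointMass a y).toReal * M.conditionalMean (y M.rewardNode) := by
    intro y
    rw [integral_smul_measure, integral_map (measurable_pair y).aemeasurable (by fun_prop)]
    rfl
  simp only [h1, prob_eq_sum, sum_mul]
  rw [sum_comm]
  simp [ite_mul]

theorem HasBoundedMeansAndSubgaussianNoise.meanReward_do_rewardNode (k : Fin K) :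
    M.meanReward (some (M.rewardNode, k)) = M.conditionalMean k := by
  rw [hM.meanReward_eq]
  simp [prob_do_self]

theorem HasBoundedMeansAndSubgaussianNoise.meanReward_do_eq {root : V} {depth : V → ℕ}
    (hD : IsRootedAt M.graph root depth) {v : V}
    (hv : M.rewardNode ∉ descendants M.graph v) (x : Fin K) :
    M.meanReward (some (v, x)) = M.meanReward none := by
  rw [hM.meanReward_eq, hM.meanReward_eq]
  simp only [M.prob_do_eq hD hv]

/-- The content is the case of do(), whose mean is not bounded by assumption. -/
theorem HasBoundedMeansAndSubgaussianNoise.meanReward_nonneg (a : Intervention V K) :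
    0 ≤ M.meanReward a := by
  rw [hM.meanReward_eq]
  refine sum_nonneg fun k _ => mul_nonneg (M.prob_nonneg _ _ _) ?_
  rw [← hM.meanReward_do_rewardNode]
  exact (hM.1 _).1

theorem HasBoundedMeansAndSubgaussianNoise.optimalReward_le_one : M.optimalReward ≤ 1 :=
  Real.iSup_le (fun p => (hM.1 p).2) zero_le_one

theorem HasBoundedMeansAndSubgaussianNoise.meanReward_do_le (p : V × Fin K) :
    M.meanReward (some p) ≤ M.optimalReward :=
  le_ciSup (f := fun p : V × Fin K => M.meanReward (some p))
    ⟨1, by rintro _ ⟨p, rfl⟩; exact (hM.1 p).2⟩ p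

theorem HasBoundedMeansAndSubgaussianNoise.meanReward_le_of_forall {b : ℝ}
    (hb : ∀ k, M.meanReward (some (M.rewardNode, k)) ≤ b) (a : Intervention V K) :
    M.meanReward a ≤ b := by
  rw [hM.meanReward_eq, ← one_mul b, ← M.sum_prob a M.rewardNode, sum_mul]
  refine sum_le_sum fun k _ => mul_le_mul_of_nonneg_left ?_ (M.prob_nonneg _ _ _)
  rw [← hM.meanReward_do_rewardNode]
  exact hb k

theorem HasBoundedMeansAndSubgaussianNoise.meanReward_le (a : Intervention V K) :
    M.meanReward a ≤ M.optimalReward :=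
  hM.meanReward_le_of_forall (fun _ => hM.meanReward_do_le _) a

/-- Some intervention on the reward generating variable is optimal. -/
theorem HasBoundedMeansAndSubgaussianNoise.exists_optimal [Nonempty (Fin K)] :
    ∃ k, M.meanReward (some (M.rewardNode, k)) = M.optimalReward := by
  obtain ⟨k, hk⟩ := Finite.exists_max fun k => M.meanReward (some (M.rewardNode, k))
  refine ⟨k, le_antisymm (hM.meanReward_do_le _) ?_⟩
  have : Nonempty (V × Fin K) := ⟨(M.rewardNode, k)⟩
  exact ciSup_le fun p => hM.meanReward_le_of_forall hk (some p)

theorem HasBoundedMeansAndSubgaussianNoise.regret_le (T : ℕ) {l : List (Intervention V K)}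
    (hl : l.length = T) :
    M.regret T l = (l.map fun a => M.optimalReward - M.meanReward a).sum := by
  subst hl
  rw [regret]
  induction l with
  | nil => simp
  | cons a l ih =>
    simp only [List.length_cons, List.map_cons, List.sum_cons, ← ih]
    push_cast
    ring

/-- Every round costs at most one. -/
theorem HasBoundedMeansAndSubgaussianNoise.sum_gap_le_length (l : List (Intervention V K)) :
    (l.map fun a => M.optimalReward - M.meanReward a).sum ≤ l.length := by
  induction l with
  | nil => simp
  | cons a l ih =>
    simp only [List.length_cons, List.map_cons, List.sum_cons]
    push_cast
    have := hM.optimalReward_le_one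
    have := hM.meanReward_nonneg a
    linarith

theorem HasBoundedMeansAndSubgaussianNoise.sum_gap_take_le (l : List (Intervention V K)) (t : ℕ) :
    ((l.take t).map fun a => M.optimalReward - M.meanReward a).sum ≤
      (l.map fun a => M.optimalReward - M.meanReward a).sum := by
  induction l generalizing t with
  | nil => simp
  | cons a l ih =>
    have ha := hM.meanReward_le a
    cases t with
    | zero =>
      have := ih 0
      simp only [List.take_zero, List.map_nil, List.sum_nil, List.map_cons, List.sum_cons] at this ⊢
      linarith
    | succ t =>
      have := ih t
      simp only [List.take_succ_cons, List.map_cons, List.sum_cons]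
      linarith

/-- Reward identifiability needs at least two values. -/
theorem HasBoundedMeansAndSubgaussianNoise.two_le_card {Δ : ℝ} (hΔ : 0 < Δ)
    (hR : M.RewardIdentifiable Δ) : 2 ≤ K := by
  obtain ⟨x, hx⟩ := hR M.rewardNode .refl
  by_contra hK
  have h0 : K = 1 := by have := x.pos; omega
  subst h0
  have h1 : M.meanReward none = M.meanReward (some (M.rewardNode, x)) := by
    rw [hM.meanReward_eq, hM.meanReward_do_rewardNode]
    have := M.sum_prob none M.rewardNode
    rw [Fin.sum_univ_one] at this ⊢
    rw [this, one_mul, Subsingleton.elim x 0]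
  rw [h1, sub_self, abs_zero] at hx
  linarith

/-- Hence `1 / Δ ^ 2` is at least one and absorbs additive constants, such as the rounding in the
batch size. -/
theorem HasBoundedMeansAndSubgaussianNoise.gap_le_one {Δ : ℝ}
    (hR : M.RewardIdentifiable Δ) : Δ ≤ 1 := by
  obtain ⟨x, hx⟩ := hR M.rewardNode .refl
  refine hx.trans (abs_le.2 ⟨?_, ?_⟩) <;>
    linarith [hM.meanReward_nonneg none, hM.meanReward_le none, hM.optimalReward_le_one,
      hM.meanReward_nonneg (some (M.rewardNode, x)), hM.meanReward_do_le (M.rewardNode, x)]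

end Means

end CausalBandit

/-! ### The regret of UCB on reliable data -/

namespace LearnerInput

open Strategy

variable {V : Type} [Fintype V] [DecidableEq V] {K : ℕ}

/-- A bound on the regret of the play of an arm after `i` earlier plays. -/
noncomputable def playCost (L : ℝ) (i : ℕ) : ℝ := if i = 0 then 1 else 2 * Real.sqrt (2 * L / i)

/-- The averages of the rewards of every arm over an initial segment are within the width of the
confidence interval. -/
def ReliableRewards (T : ℕ) (L : ℝ) (X : Fin K → ℕ → ℝ) (μ : Fin K → ℝ) : Prop :=
  ∀ k, ∀ N, 1 ≤ N → N ≤ T → |(∑ i ∈ range N, X k i) / N - μ k| ≤ Real.sqrt (2 * L / N)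

/-- Optimism: the index of `k₀` is at least its mean, and the index of `k` exceeds its mean by at
most two widths. If `k` has been played, so has `k₀`, since an unplayed arm has infinite index. -/
theorem gap_le_playCost {T : ℕ} {L : ℝ} {X : Fin K → ℕ → ℝ} {μ : Fin K → ℝ}
    (hX : ReliableRewards T L X μ) {k₀ : Fin K} (hμ : ∀ k, μ k₀ - μ k ≤ 1) {N : Fin K → ℕ}
    (hN : ∀ k, N k ≤ T) {k : Fin K}
    (hk : ucbIndex L (N k₀) (∑ i ∈ range (N k₀), X k₀ i) ≤
      ucbIndex L (N k) (∑ i ∈ range (N k), X k i)) :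
    μ k₀ - μ k ≤ playCost L (N k) := by
  unfold playCost
  split_ifs with h0
  · exact hμ k
  · have h0' : N k₀ ≠ 0 := by
      intro h
      rw [ucbIndex, if_pos h, ucbIndex, if_neg h0, top_le_iff] at hk
      exact EReal.coe_ne_top _ hk
    rw [ucbIndex, if_neg h0', ucbIndex, if_neg h0, EReal.coe_le_coe_iff] at hk
    have h1 := abs_le.1 (hX k (N k) (by omega) (hN k))
    have h2 := abs_le.1 (hX k₀ (N k₀) (by omega) (hN k₀))
    linarith [h1.1, h1.2, h2.1, h2.2]

/-- The sum of the play costs is a potential that pays for each round. The offset `o` accounts for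
plays of the same arms made by the search stages. -/
theorem exec_ucb {Z : Intervention V K → ℕ → Outcome V K} {T : ℕ} {L : ℝ} (x : V)
    {o : Fin K → ℕ} {μ : Intervention V K → ℝ}
    (hX : ReliableRewards T L (fun k i => (Z (some (x, k)) (o k + i)).2) fun k => μ (some (x, k)))
    {k₀ : Fin K} (hμ : ∀ k, μ (some (x, k₀)) - μ (some (x, k)) ≤ 1) (t : ℕ) :
    ∀ (N : Fin K → ℕ) (s : Fin K → ℝ) (cnt : Intervention V K → ℕ),
      ∑ k, N k + t ≤ T → (∀ k, cnt (some (x, k)) = o k + N k) →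
      (∀ k, s k = ∑ i ∈ range (N k), (Z (some (x, k)) (o k + i)).2) →
      (exec Z cnt (ucb x L t N s)).1.length = t ∧
      ∃ N' : Fin K → ℕ, ∑ k, N' k = ∑ k, N k + t ∧
        ((exec Z cnt (ucb x L t N s)).1.map fun a => μ (some (x, k₀)) - μ a).sum +
          ∑ k, ∑ i ∈ range (N k), playCost L i ≤ ∑ k, ∑ i ∈ range (N' k), playCost L i := by
  induction t with
  | zero =>
    intro N s cnt _ _ _
    exact ⟨by simp [ucb, exec], N, by simp, by simp [ucb, exec]⟩
  | succ t ih =>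
    intro N s cnt hT hcnt hs
    have hNT : ∀ k, N k ≤ T := fun k =>
      (single_le_sum (f := N) (fun _ _ => Nat.zero_le _) (mem_univ k)).trans (by omega)
    rw [ucb]
    split
    · rename_i hnone
      rw [List.argmax_eq_none] at hnone
      have := List.mem_finRange k₀
      rw [hnone] at this
      simp at this
    · rename_i k hk
      have hidx := List.le_of_mem_argmax (List.mem_finRange k₀) hk
      rw [hs, hs] at hidx
      have hcost := gap_le_playCost (k₀ := k₀) hX hμ hNT hidx
      have hsum : ∑ j, Function.update N k (N k + 1) j = ∑ j, N j + 1 := by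
        rw [sum_update_of_mem (mem_univ k), ← add_sum_erase univ N (mem_univ k),
          sdiff_singleton_eq_erase]
        ring
      obtain ⟨hlen, N', hN', hreg⟩ := ih (Function.update N k (N k + 1))
        (Function.update s k (s k + (Z (some (x, k)) (cnt (some (x, k)))).2))
        (Function.update cnt (some (x, k)) (cnt (some (x, k)) + 1))
        (by rw [hsum]; omega)
        (by
          intro j
          by_cases hj : j = k
          · subst hj
            simp [hcnt, add_assoc]
          · simp [hj, hcnt])
        (by
          intro j
          by_cases hj : j = k
          · subst hj
            simp [hcnt, hs, sum_range_succ]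
          · simp [hj, hs])
      have hcs : ∑ j, ∑ i ∈ range (Function.update N k (N k + 1) j), playCost L i =
          ∑ j, ∑ i ∈ range (N j), playCost L i + playCost L (N k) := by
        have hrest : ∀ j ∈ univ.erase k,
            ∑ i ∈ range (Function.update N k (N k + 1) j), playCost L i =
              ∑ i ∈ range (N j), playCost L i := fun j hj => by
          rw [Function.update_of_ne (mem_erase.1 hj).1]
        rw [← add_sum_erase univ _ (mem_univ k), sum_congr rfl hrest, Function.update_self,
          sum_range_succ, ← add_sum_erase univ (fun j => ∑ i ∈ range (N j), playCost L i)
          (mem_univ k)]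
        ring
      refine ⟨by simp [exec, hlen], N', by rw [hN', hsum]; omega, ?_⟩
      rw [hcs] at hreg
      simp only [exec, List.map_cons, List.sum_cons]
      linarith

theorem sum_range_playCost_le {L : ℝ} (N : ℕ) :
    ∑ i ∈ range N, playCost L i ≤ Real.sqrt N * (1 + 6 * Real.sqrt (2 * L)) := by
  have hstep : ∀ n : ℕ, 1 ≤ n →
      ∑ i ∈ range n, playCost L i ≤ 1 + 6 * Real.sqrt (2 * L) * Real.sqrt n := by
    intro n hn
    induction n, hn using Nat.le_induction with
    | base =>
      have := Real.sqrt_nonneg (2 * L)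
      simp [playCost]
    | succ n hn ih =>
      rw [sum_range_succ, playCost, if_neg (by omega)]
      have hn0 : (0 : ℝ) < n := by exact_mod_cast hn
      have hs0 : 0 < Real.sqrt n := Real.sqrt_pos.2 hn0
      have h1 : Real.sqrt (2 * L / n) = Real.sqrt (2 * L) / Real.sqrt n :=
        Real.sqrt_div' _ hn0.le
      -- The difference of the roots is the inverse of their sum, which is at most `3 * √n`; the sum
      -- of the widths then telescopes.
      have h2 : 1 / Real.sqrt n ≤ 3 * (Real.sqrt ((n : ℝ) + 1) - Real.sqrt n) := by
        have ha : Real.sqrt n ^ 2 = n := Real.sq_sqrt hn0.le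
        have hb : Real.sqrt ((n : ℝ) + 1) ^ 2 = n + 1 := Real.sq_sqrt (by positivity)
        have hc : Real.sqrt n ≤ Real.sqrt ((n : ℝ) + 1) := Real.sqrt_le_sqrt (by linarith)
        have hd : Real.sqrt ((n : ℝ) + 1) ≤ 2 * Real.sqrt n := by
          rw [Real.sqrt_le_left (by positivity), mul_pow, ha]
          have : (1 : ℝ) ≤ n := by exact_mod_cast hn
          linarith
        rw [div_le_iff₀ hs0]
        nlinarith [mul_nonneg (sub_nonneg.2 hc) (sub_nonneg.2 hd)]
      have h3 := mul_le_mul_of_nonneg_left h2 (Real.sqrt_nonneg (2 * L))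
      rw [h1]
      push_cast
      have h4 : 2 * (Real.sqrt (2 * L) / Real.sqrt n) =
        2 * (Real.sqrt (2 * L) * (1 / Real.sqrt n)) := by ring
      rw [h4]
      linarith
  rcases Nat.eq_zero_or_pos N with rfl | hN
  · simp
  · have h1 : 1 ≤ Real.sqrt N := Real.one_le_sqrt.2 (by exact_mod_cast hN)
    linarith [hstep N hN]

end LearnerInput

/-! ### Concentration -/

theorem measure_exists_le {Ω ι : Type*} [MeasurableSpace Ω] [Fintype ι] (P : Measure Ω)
    {p : ι → Ω → Prop} {b c : ℝ} (hb : ∀ i, P {ω | p i ω} ≤ ENNReal.ofReal b)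
    (hc : Fintype.card ι * b ≤ c) : P {ω | ∃ i, p i ω} ≤ ENNReal.ofReal c := by
  have h : {ω | ∃ i, p i ω} = ⋃ i, {ω | p i ω} := by
    ext ω
    simp
  rw [h]
  refine (measure_iUnion_fintype_le P _).trans ((sum_le_sum fun i _ => hb i).trans ?_)
  rw [sum_const, nsmul_eq_mul, card_univ, ← ENNReal.ofReal_natCast,
    ← ENNReal.ofReal_mul (Nat.cast_nonneg _)]
  exact ENNReal.ofReal_le_ofReal hc

section Concentration

variable {V : Type} [Fintype V] [DecidableEq V] {K : ℕ} {M : CausalBandit V K}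
  {Ω : Type*} [MeasurableSpace Ω] {P : Measure Ω} [IsProbabilityMeasure P]
  {Z : Intervention V K → ℕ → Ω → Outcome V K}

/-- Two one-sided Chernoff bounds. The shift `s` selects a block of plays and is deterministic. -/
theorem measure_average_deviation_le (hZ : ∀ a i, HasLaw (Z a i) (M.outcomeLaw a) P)
    (hind : iIndepFun (fun p : Intervention V K × ℕ => Z p.1 p.2) P)
    (a : Intervention V K) (s N : ℕ) (hN : 1 ≤ N) {g : Outcome V K → ℝ} (hg : Measurable g)
    {m : ℝ} {c : NNReal} (hsub : HasSubgaussianMGF (fun o => g o - m) c (M.outcomeLaw a)) {e : ℝ}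
    (he : 0 ≤ e) :
    P {ω | e ≤ |(∑ i ∈ range N, g (Z a (s + i) ω)) / N - m|} ≤
      ENNReal.ofReal (2 * Real.exp (-(N * e ^ 2) / (2 * c))) := by
  have hN0 : (0 : ℝ) < N := by exact_mod_cast hN
  let X : ℕ → Ω → ℝ := fun i ω => g (Z a (s + i) ω) - m
  have hX : ∀ i, HasSubgaussianMGF (X i) c P := fun i =>
    HasSubgaussianMGF.of_map (X := fun o => g o - m) (hZ a (s + i)).aemeasurable
      (by rw [(hZ a (s + i)).map_eq]; exact hsub)
  have hindX : iIndepFun X P := by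
    have h1 := hind.precomp (g := fun i : ℕ => (a, s + i)) (by
      intro i j hij
      simpa using hij)
    exact h1.comp (fun _ o => g o - m) fun _ => hg.sub_const m
  have hindX' : iIndepFun (fun i => -X i) P :=
    hindX.comp (fun _ x => -x) fun _ => measurable_neg
  have h1 := HasSubgaussianMGF.measure_sum_range_ge_le_of_iIndepFun hindX (n := N)
    (fun i _ => hX i) (mul_nonneg hN0.le he)
  have h2 := HasSubgaussianMGF.measure_sum_range_ge_le_of_iIndepFun hindX' (n := N)
    (fun i _ => (hX i).neg) (mul_nonneg hN0.le he)
  have hexp : -(N * e) ^ 2 / (2 * N * c) = -(N * e ^ 2) / (2 * (c : ℝ)) := by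
    by_cases hc : (c : ℝ) = 0
    · simp [hc]
    · field_simp
  rw [hexp] at h1 h2
  have hsubset : {ω | e ≤ |(∑ i ∈ range N, g (Z a (s + i) ω)) / N - m|} ⊆
      {ω | N * e ≤ ∑ i ∈ range N, X i ω} ∪ {ω | N * e ≤ ∑ i ∈ range N, (-X i) ω} := by
    intro ω hω
    have hsum : ∑ i ∈ range N, X i ω =
        N * ((∑ i ∈ range N, g (Z a (s + i) ω)) / N - m) := by
      simp only [X, sum_sub_distrib, sum_const, card_range, nsmul_eq_mul]
      field_simp
    simp only [Set.mem_union, Set.mem_ofPred_eq, Pi.neg_apply, sum_neg_distrib, hsum] at hω ⊢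
    rcases le_abs.1 hω with h | h
    · exact Or.inl (mul_le_mul_of_nonneg_left h hN0.le)
    · right
      rw [← mul_neg]
      exact mul_le_mul_of_nonneg_left h hN0.le
  refine (measure_mono hsubset).trans ((measure_union_le _ _).trans ?_)
  rw [two_mul, ENNReal.ofReal_add (Real.exp_pos _).le (Real.exp_pos _).le]
  refine add_le_add ?_ ?_
  · rw [← ofReal_measureReal]
    exact ENNReal.ofReal_le_ofReal h1
  · rw [← ofReal_measureReal]
    exact ENNReal.ofReal_le_ofReal h2

namespace CausalBandit

-- Hoeffding's lemma: a variable with values in an interval of length one has variance proxy `1 /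
-- 4`.
open Classical in
theorem hasSubgaussianMGF_indicator [∀ a, IsProbabilityMeasure (M.outcomeLaw a)]
    (a : Intervention V K) (v : V) (k : Fin K) :
    HasSubgaussianMGF (fun o : Outcome V K => (if o.1 v = k then (1 : ℝ) else 0) - M.prob a v k)
      (1 / 4) (M.outcomeLaw a) := by
  have hs : MeasurableSet {o : Outcome V K | o.1 v = k} :=
    measurable_fst (Set.toFinite {y : V → Fin K | y v = k}).measurableSet
  have hmeas : Measurable fun o : Outcome V K => if o.1 v = k then (1 : ℝ) else 0 :=
    Measurable.ite hs measurable_const measurable_const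
  have h := hasSubgaussianMGF_of_mem_Icc (μ := M.outcomeLaw a) (a := 0) (b := 1)
    hmeas.aemeasurable (Filter.Eventually.of_forall fun o => by
      split_ifs <;> simp)
  have hint : ∫ o : Outcome V K, (if o.1 v = k then (1 : ℝ) else 0) ∂M.outcomeLaw a =
      M.prob a v k := by
    have : (fun o : Outcome V K => if o.1 v = k then (1 : ℝ) else 0) =
        {o : Outcome V K | o.1 v = k}.indicator 1 := by
      funext o
      simp [Set.indicator_apply]
    rw [this, integral_indicator_one hs]
    rfl
  rw [hint] at h
  convert h using 1
  ext
  norm_num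

end CausalBandit

end Concentration

open Classical in
/-- All the empirical averages that CN-UCB relies on are accurate. -/
structure CausalBandit.IsGoodSample {V : Type} [Fintype V] [DecidableEq V] {K : ℕ}
    (M : CausalBandit V K) (Δ ε : ℝ) (B T : ℕ) (L : ℝ)
    (Z : Intervention V K → ℕ → Outcome V K) : Prop where
  observation : |(∑ i ∈ range B, (Z none (0 + i)).2) / B - M.meanReward none| < Δ / 4
  reward : ∀ v z, ∀ j < 3,
    |(∑ i ∈ range B, (Z (some (v, z)) (B * j + i)).2) / B - M.meanReward (some (v, z))| < Δ / 4
  effect : ∀ v y, (skeleton M.graph).Adj v y → ∀ z k,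
    |(∑ i ∈ range B, if (Z (some (v, z)) (0 + i)).1 y = k then (1 : ℝ) else 0) / B -
      M.prob (some (v, z)) y k| ≤ ε / 2
  -- UCB starts after `j ≤ 3` interventions on the reward node, so four offsets have to be covered.
  arms : ∀ j < 4, LearnerInput.ReliableRewards T L
    (fun k i => (Z (some (M.rewardNode, k)) (B * j + i)).2)
    (fun k => M.meanReward (some (M.rewardNode, k)))

/-- Directions are only tested along edges, so the union bound runs over `2 * n - 2` ordered pairs.
-/
theorem IsDirectedTree.card_dart {n : ℕ} {D : Digraph (Fin n)} (h : IsDirectedTree D) :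
    Nat.card (skeleton D).Dart + 2 = 2 * n := by
  classical
  have h1 := h.1.card_edgeFinset
  rw [Fintype.card_fin] at h1
  rw [Nat.card_eq_fintype_card, SimpleGraph.dart_card_eq_twice_card_edges]
  omega

/-! ### Tail bounds for the chosen batch size. -/

section BatchSize

variable {n K : ℕ} {Δ ε δ : ℝ}

theorem exp_batchSize_reward_le (hn : 2 ≤ n) (hK : 2 ≤ K) (hΔ : 0 < Δ) (hδ : 0 < δ) :
    Real.exp (-(batchSize n K Δ ε δ * (Δ / 4) ^ 2) / (2 * (1 : NNReal))) ≤ δ / (8 * n * K) := by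
  have hn0 : (0 : ℝ) < n := by exact_mod_cast (by omega : 0 < n)
  have hK0 : (0 : ℝ) < K := by exact_mod_cast (by omega : 0 < K)
  have hB : 32 / Δ ^ 2 * Real.log (8 * n * K / δ) ≤ batchSize n K Δ ε δ :=
    (le_max_left _ _).trans (Nat.le_ceil _)
  have h1 : δ / (8 * n * K) = Real.exp (-Real.log (8 * n * K / δ)) := by
    rw [Real.exp_neg, Real.exp_log (by positivity), inv_div]
  rw [h1, Real.exp_le_exp]
  have h2 : Real.log (8 * n * K / δ) =
      32 / Δ ^ 2 * Real.log (8 * n * K / δ) * (Δ / 4) ^ 2 / 2 := by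
    field_simp
    ring
  rw [NNReal.coe_one, mul_one, neg_div, neg_le_neg_iff, h2]
  gcongr

theorem exp_batchSize_effect_le (hn : 2 ≤ n) (hK : 2 ≤ K) (hε : 0 < ε) (hδ : 0 < δ) :
    Real.exp (-(batchSize n K Δ ε δ * (ε / 2) ^ 2) / (2 * (1 / 4 : NNReal))) ≤
      δ / (8 * (n : ℝ) ^ 2 * (K : ℝ) ^ 2) := by
  have hn0 : (0 : ℝ) < n := by exact_mod_cast (by omega : 0 < n)
  have hK0 : (0 : ℝ) < K := by exact_mod_cast (by omega : 0 < K)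
  have hB : 2 / ε ^ 2 * Real.log (8 * (n : ℝ) ^ 2 * (K : ℝ) ^ 2 / δ) ≤ batchSize n K Δ ε δ :=
    (le_max_right _ _).trans (Nat.le_ceil _)
  have h1 : δ / (8 * (n : ℝ) ^ 2 * (K : ℝ) ^ 2) =
      Real.exp (-Real.log (8 * (n : ℝ) ^ 2 * (K : ℝ) ^ 2 / δ)) := by
    rw [Real.exp_neg, Real.exp_log (by positivity), inv_div]
  rw [h1, Real.exp_le_exp]
  have h2 : Real.log (8 * (n : ℝ) ^ 2 * (K : ℝ) ^ 2 / δ) =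
      2 / ε ^ 2 * Real.log (8 * (n : ℝ) ^ 2 * (K : ℝ) ^ 2 / δ) * (ε / 2) ^ 2 * 2 := by
    field_simp
  have h3 : -(batchSize n K Δ ε δ * (ε / 2) ^ 2) / (2 * ((1 / 4 : NNReal) : ℝ)) =
      -(batchSize n K Δ ε δ * (ε / 2) ^ 2 * 2) := by
    push_cast
    ring
  rw [h3, neg_le_neg_iff, h2]
  gcongr

theorem one_le_batchSize (hn : 2 ≤ n) (hK : 2 ≤ K) (hΔ : 0 < Δ) (hδ : 0 < δ) (hδ1 : δ < 1) :
    1 ≤ batchSize n K Δ ε δ := by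
  have hn0 : (2 : ℝ) ≤ n := by exact_mod_cast hn
  have hK0 : (2 : ℝ) ≤ K := by exact_mod_cast hK
  refine Nat.one_le_ceil_iff.2 (lt_max_of_lt_left (mul_pos (by positivity) (Real.log_pos ?_)))
  rw [lt_div_iff₀ hδ]
  nlinarith

end BatchSize

-- The failure probability splits as `δ/16` for do(), `3δ/4` for three batches per intervention,
-- `δ/8` for edge directions and `δ/16` for the arms. The last share is where `128 ≤ K * T` enters:
-- the arms cost `8δ / (K * T)`.
set_option maxHeartbeats 1000000 in
theorem measure_not_isGoodSample_le {n K T : ℕ} {Δ ε δ : ℝ} {M : CausalBandit (Fin n) K}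
    {Ω : Type*} [MeasurableSpace Ω] {P : Measure Ω} [IsProbabilityMeasure P]
    {Z : Intervention (Fin n) K → ℕ → Ω → Outcome (Fin n) K}
    [∀ a, IsProbabilityMeasure (M.outcomeLaw a)]
    (hn : 2 ≤ n) (hK : 2 ≤ K) (hKT : 128 ≤ K * T) (hΔ : 0 < Δ) (hε : 0 < ε) (hδ : 0 < δ)
    (hδ1 : δ < 1) (hD : IsDirectedTree M.graph) (hM : M.HasBoundedMeansAndSubgaussianNoise)
    (hZ : ∀ a i, HasLaw (Z a i) (M.outcomeLaw a) P)
    (hind : iIndepFun (fun p : Intervention (Fin n) K × ℕ => Z p.1 p.2) P) :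
    P {ω | ¬ M.IsGoodSample Δ ε (batchSize n K Δ ε δ) T
        (Real.log (((K : ℝ) * T) ^ 2 / δ)) fun a i => Z a i ω} ≤ ENNReal.ofReal δ := by
  classical
  set B := batchSize n K Δ ε δ with hBdef
  set L := Real.log (((K : ℝ) * T) ^ 2 / δ) with hL
  have hB : 1 ≤ B := one_le_batchSize hn hK hΔ hδ hδ1
  have hn0 : (2 : ℝ) ≤ n := by exact_mod_cast hn
  have hK0 : (2 : ℝ) ≤ K := by exact_mod_cast hK
  have hKT0 : (128 : ℝ) ≤ K * T := by exact_mod_cast hKT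
  have hL0 : 0 ≤ L := by
    refine Real.log_nonneg ?_
    rw [le_div_iff₀ hδ]
    nlinarith
  have hreward : ∀ a s, P {ω | Δ / 4 ≤
      |(∑ i ∈ range B, (Z a (s + i) ω).2) / B - M.meanReward a|} ≤
      ENNReal.ofReal (2 * (δ / (8 * n * K))) := fun a s =>
    (measure_average_deviation_le hZ hind a s B hB measurable_snd (hM.2 a) (by positivity)).trans
      (ENNReal.ofReal_le_ofReal (mul_le_mul_of_nonneg_left
        (exp_batchSize_reward_le hn hK hΔ hδ) zero_le_two))
  have heffect : ∀ a (y : Fin n) k, P {ω | ε / 2 ≤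
      |(∑ i ∈ range B, if (Z a (0 + i) ω).1 y = k then (1 : ℝ) else 0) / B - M.prob a y k|} ≤
      ENNReal.ofReal (2 * (δ / (8 * (n : ℝ) ^ 2 * (K : ℝ) ^ 2))) := by
    intro a y k
    have hmeas : Measurable fun o : Outcome (Fin n) K => if o.1 y = k then (1 : ℝ) else 0 :=
      Measurable.ite (measurable_fst (Set.toFinite {x : Fin n → Fin K | x y = k}).measurableSet)
        measurable_const measurable_const
    refine (measure_average_deviation_le hZ hind a 0 B hB hmeas
      (CausalBandit.hasSubgaussianMGF_indicator a y k) (by positivity)).trans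
      (ENNReal.ofReal_le_ofReal (mul_le_mul_of_nonneg_left
        (exp_batchSize_effect_le hn hK hε hδ) zero_le_two))
  have harms : ∀ a s (N : ℕ), 1 ≤ N → P {ω | Real.sqrt (2 * L / N) ≤
      |(∑ i ∈ range N, (Z a (s + i) ω).2) / N - M.meanReward a|} ≤
      ENNReal.ofReal (2 * (δ / (K * T) ^ 2)) := by
    intro a s N hN
    have hN0 : (0 : ℝ) < N := by exact_mod_cast hN
    refine (measure_average_deviation_le hZ hind a s N hN measurable_snd (hM.2 a)
      (Real.sqrt_nonneg _)).trans (ENNReal.ofReal_le_ofReal (mul_le_mul_of_nonneg_left ?_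
        zero_le_two))
    have h1 : -(N * Real.sqrt (2 * L / N) ^ 2) / (2 * ((1 : NNReal) : ℝ)) = -L := by
      rw [Real.sq_sqrt (by positivity), NNReal.coe_one]
      field_simp
    rw [h1, hL, Real.exp_neg, Real.exp_log (by positivity), inv_div]
  have hA0 := hreward none 0
  have hA1 := measure_exists_le P (ι := (Fin n × Fin K) × Fin 3) (c := 3 / 4 * δ)
    (p := fun q ω => Δ / 4 ≤ |(∑ i ∈ range B, (Z (some q.1) (B * q.2 + i) ω).2) / B -
      M.meanReward (some q.1)|) (fun q => hreward (some q.1) (B * q.2)) (by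
        simp only [Fintype.card_prod, Fintype.card_fin]
        push_cast
        apply le_of_eq
        field_simp
        norm_num)
  have hA2 := measure_exists_le P (ι := (skeleton M.graph).Dart × Fin K × Fin K) (c := δ / 8)
    (p := fun q ω => ε / 2 ≤ |(∑ i ∈ range B,
      if (Z (some (q.1.fst, q.2.1)) (0 + i) ω).1 q.1.snd = q.2.2 then (1 : ℝ) else 0) / B -
      M.prob (some (q.1.fst, q.2.1)) q.1.snd q.2.2|) (fun q => heffect _ _ _) (by
        simp only [Fintype.card_prod, Fintype.card_fin]
        have hd : (Fintype.card (skeleton M.graph).Dart : ℝ) = 2 * n - 2 := by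
          have := hD.card_dart
          rw [Nat.card_eq_fintype_card] at this
          have h2 : ((Fintype.card (skeleton M.graph).Dart + 2 : ℕ) : ℝ) = (2 * n : ℕ) := by
            rw [this]
          push_cast at h2
          linarith
        push_cast
        rw [hd]
        have h1 : (2 * (n : ℝ) - 2) * (K * K) * (2 * (δ / (8 * (n : ℝ) ^ 2 * (K : ℝ) ^ 2))) =
            δ / 8 * ((4 * n - 4) / (n : ℝ) ^ 2) := by
          field_simp
          ring
        rw [h1]
        refine mul_le_of_le_one_right (by positivity) ?_
        rw [div_le_one (by positivity)]
        nlinarith [sq_nonneg ((n : ℝ) - 2)])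
  -- The element `q.2` of `Fin T` stands for the sample size `q.2 + 1`, so the sizes run from 1 to
  -- `T`.
  have hA3 := measure_exists_le P (ι := (Fin K × Fin 4) × Fin T) (c := δ / 16)
    (p := fun q ω => Real.sqrt (2 * L / (q.2 + 1 : ℕ)) ≤
      |(∑ i ∈ range (q.2 + 1), (Z (some (M.rewardNode, q.1.1)) (B * q.1.2 + i) ω).2) /
        (q.2 + 1 : ℕ) - M.meanReward (some (M.rewardNode, q.1.1))|)
    (fun q => harms _ _ _ (by omega)) (by
        simp only [Fintype.card_prod, Fintype.card_fin]
        push_cast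
        have h1 : (K : ℝ) * 4 * T * (2 * (δ / (K * T) ^ 2)) = δ / 16 * (128 / (K * T)) := by
          have : (T : ℝ) ≠ 0 := by rintro h; rw [h] at hKT0; norm_num at hKT0
          field_simp
          norm_num
        rw [h1]
        refine mul_le_of_le_one_right (by positivity) ?_
        rw [div_le_one (by linarith)]
        exact hKT0)
  have hA0' : ENNReal.ofReal (2 * (δ / (8 * n * K))) ≤ ENNReal.ofReal (δ / 16) := by
    refine ENNReal.ofReal_le_ofReal ?_
    have h1 : 2 * (δ / (8 * n * K)) = δ / 16 * (4 / (n * K)) := by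
      field_simp
      norm_num
    rw [h1]
    refine mul_le_of_le_one_right (by positivity) ?_
    rw [div_le_one (by positivity)]
    nlinarith
  refine (measure_mono ?_).trans ((measure_union_le _ _).trans (add_le_add
    ((measure_union_le _ _).trans (add_le_add ((measure_union_le _ _).trans
      (add_le_add (hA0.trans hA0') hA1)) hA2)) hA3)) |>.trans ?_
  · intro ω hω
    by_contra hcon
    simp only [Set.mem_union, Set.mem_ofPred_eq, not_or, not_exists, not_le] at hcon hω
    obtain ⟨⟨⟨h0, h1⟩, h2⟩, h3⟩ := hcon
    refine hω ⟨h0, fun v z j hj => h1 ((v, z), ⟨j, hj⟩),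
      fun v y hvy z k => (h2 (⟨(v, y), hvy⟩, z, k)).le, fun j hj k N hN1 hN => ?_⟩
    have := h3 ((k, ⟨j, hj⟩), ⟨N - 1, by omega⟩)
    simp only [Nat.sub_add_cancel hN1] at this
    exact this.le
  · rw [← ENNReal.ofReal_add, ← ENNReal.ofReal_add, ← ENNReal.ofReal_add]
    · exact ENNReal.ofReal_le_ofReal (by linarith)
    all_goals positivity

/-! ### The regret of CN-UCB on a good sample -/

namespace LearnerInput

open Strategy

variable {V : Type} [Fintype V] [DecidableEq V] {K : ℕ}

theorem rewardMean_map_range (B : ℕ) (f : ℕ → Outcome V K) :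
    rewardMean ((List.range B).map f) = (∑ i ∈ range B, (f i).2) / B := by
  rw [rewardMean, List.map_map, List.length_map, List.length_range]
  rfl

open Classical in
theorem freq_map_range (B : ℕ) (f : ℕ → Outcome V K) (y : V) (k : Fin K) :
    freq ((List.range B).map f) y k =
      (∑ i ∈ range B, if (f i).1 y = k then (1 : ℝ) else 0) / B := by
  rw [freq, List.length_map, List.length_range]
  congr 1
  induction B with
  | zero => simp
  | succ B ih =>
    rw [sum_range_succ, ← ih, List.range_succ, List.map_append, List.countP_append]
    push_cast
    congr 1
    by_cases h : (f B).1 y = k <;> simp [h]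

variable {I : LearnerInput V K} {M : CausalBandit V K} {Δ ε : ℝ} {T : ℕ} {L : ℝ}
  {Z : Intervention V K → ℕ → Outcome V K} {root : V} {depth : V → ℕ}
  [hP : ∀ a, IsProbabilityMeasure (M.outcomeLaw a)]

/-- On a good sample the data have no errors if the effects are identifiable. -/
theorem reliableData_of_isGoodSample (hΔ : I.rewardGap = Δ) (hε : I.effectGap = ε)
    (hobs : I.obsProb = M.prob none) (hD : IsRootedAt M.graph root depth)
    (hM : M.HasBoundedMeansAndSubgaussianNoise) (hE : M.CausalEffectIdentifiable ε)
    (hR : M.RewardIdentifiable Δ) (hG : M.IsGoodSample Δ ε I.batch T L Z) :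
    I.ReliableData Z (rewardMean ((List.range I.batch).map fun i => Z none (0 + i))) M.graph
      M.rewardNode := by
  have h0 := hG.observation
  rw [← rewardMean_map_range] at h0
  set Rhat := rewardMean ((List.range I.batch).map fun i => Z none (0 + i))
  constructor
  · intro v j hj
    have h1 : ∀ z, |rewardMean (batchData Z I.batch v j z) - M.meanReward (some (v, z))| <
        Δ / 4 := by
      intro z
      have := hG.reward v z j hj
      rwa [← rewardMean_map_range (f := fun i => Z (some (v, z)) (I.batch * j + i))] at this
    rw [RewardShift, hΔ]
    constructor
    · rintro ⟨z, hz⟩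
      by_contra hv
      have h2 := h1 z
      rw [hM.meanReward_do_eq hD hv] at h2
      -- Both averages are within `Δ / 4` of the same mean. For an ancestor the means differ by at
      -- least `Δ`, which leaves more than `Δ / 2`.
      refine hz.not_ge ?_
      rw [abs_lt] at h0 h2
      rw [abs_le]
      constructor <;> linarith
    · intro hv
      obtain ⟨z, hz⟩ := hR v (mem_descendants.1 hv)
      refine ⟨z, ?_⟩
      have h2 := h1 z
      rw [abs_lt] at h0 h2
      rcases le_abs.1 hz with h | h
      · exact lt_of_lt_of_le (by linarith) (le_abs_self _)
      · exact lt_of_lt_of_le (by linarith) (neg_le_abs _)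
  · intro v y hvy
    have h1 : ∀ z k, |freq (batchData Z I.batch v 0 z) y k - M.prob (some (v, z)) y k| ≤
        ε / 2 := by
      intro z k
      have := hG.effect v y hvy z k
      rwa [← freq_map_range (f := fun i => Z (some (v, z)) (0 + i))] at this
    rw [PointsDown, hε, hobs]
    constructor
    · rintro ⟨z, k, hz⟩
      refine (hD.skeleton_adj.1 hvy).resolve_right fun hyv => ?_
      have h2 := h1 z k
      rw [M.prob_do_eq hD (hD.not_mem_descendants_of_adj hyv), abs_sub_comm] at h2
      exact hz.not_ge h2
    · intro h
      obtain ⟨k, z, hkz⟩ := hE v y h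
      refine ⟨z, k, ?_⟩
      have h2 := h1 z k
      rw [abs_le] at h2
      rcases lt_abs.1 hkz with h | h
      · exact lt_of_lt_of_le (by linarith) (neg_le_abs _)
      · exact lt_of_lt_of_le (by linarith) (le_abs_self _)

/-- The node found by the search stages, and the number of rounds they take. -/
theorem exec_cnUCB (hT : I.tree = skeleton M.graph) (hΔ : I.rewardGap = Δ) (hε : I.effectGap = ε)
    (hobs : I.obsProb = M.prob none) (hD : IsRootedAt M.graph root depth)
    (hM : M.HasBoundedMeansAndSubgaussianNoise) (hE : M.CausalEffectIdentifiable ε)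
    (hR : M.RewardIdentifiable Δ) (hrule : IsCentralNodeRule (skeleton M.graph) I.central)
    (hG : M.IsGoodSample Δ ε I.batch T L Z) {i : ℕ} (hi : Fintype.card V < 2 ^ i)
    (hiT : i ≤ I.horizon) :
    ∃ (l : List (Intervention V K)) (m : V → ℕ),
      (exec Z (fun _ => 0) I.cnUCB).1 =
        l ++ (exec Z (batchCounts I.batch I.batch m) (ucb M.rewardNode
          (Real.log (((K : ℝ) * I.horizon) ^ 2 / I.failProb)) I.horizon
          (fun _ => 0) (fun _ => 0))).1 ∧
      l.length ≤ I.batch + (i * (K * I.batch) +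
        i * ((1 + maxDeg (skeleton M.graph)) * (K * I.batch))) ∧ m M.rewardNode ≤ 3 := by
  classical
  have hrel := reliableData_of_isGoodSample hΔ hε hobs hD hM hE hR hG
  have hd : ∀ v, ∀ s : Finset V, (∀ y ∈ s, M.graph.Adj v y) →
      s.card ≤ maxDeg (skeleton M.graph) := by
    intro v s hs
    refine le_trans ?_ (SimpleGraph.degree_le_maxDegree _ v)
    rw [← SimpleGraph.card_neighborFinset_eq_degree]
    refine card_le_card fun y hy => ?_
    rw [SimpleGraph.mem_neighborFinset]
    exact hD.skeleton_adj.2 (Or.inl (hs y hy))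
  have h0 := exec_sample (Z := Z) (fun _ => 0) (none : Intervention V K) I.batch
  have hcnt : Function.update (fun _ => 0) (none : Intervention V K) (0 + I.batch) =
      batchCounts I.batch I.batch (fun _ => 0) := by
    funext a
    rcases a with _ | ⟨v, z⟩ <;> simp [batchCounts]
  rw [hcnt] at h0
  obtain ⟨l₁, m₁, v, h1, hl₁, hm₁, hv⟩ := exec_findSubtree hD hT hrule hrel I.batch I.horizon i
    univ (fun _ => 0) hiT (by rwa [card_univ]) (mem_univ _) (fun v => Or.inl rfl)
  -- The at most one visit per node in Stage 1 is the constant 1 in `visitBound`.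
  obtain ⟨l₂, m₂, h2, hl₂, hm₂⟩ := exec_findKeyNode hD hT hrule hrel hd I.batch hv I.horizon i
    (descendants M.graph v) m₁ hiT ((card_le_univ _).trans_lt hi) hv subset_rfl (fun u => by
      have := hm₁ u
      unfold visitBound
      omega)
  refine ⟨List.replicate I.batch none ++ (l₁ ++ l₂), m₂, ?_, ?_, hm₂ _⟩
  · rw [cnUCB, exec_andThen_of_eq h0, exec_andThen_of_eq h1, exec_andThen_of_eq h2]
    simp only [List.append_assoc]
  · rw [List.length_append, List.length_append, List.length_replicate]
    omega

theorem sum_sqrt_le (T : ℕ) {N : Fin K → ℕ} (hN : ∑ k, N k = T) :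
    ∑ k, Real.sqrt (N k) ≤ Real.sqrt (K * T) := by
  refine Real.le_sqrt_of_sq_le ((sq_sum_le_card_mul_sum_sq).trans (le_of_eq ?_))
  have : ∀ k, Real.sqrt (N k) ^ 2 = N k := fun k => Real.sq_sqrt (Nat.cast_nonneg _)
  simp only [this, card_univ, Fintype.card_fin]
  rw [← hN]
  push_cast
  rfl

theorem regret_le_of_isGoodSample (hT : I.tree = skeleton M.graph) (hΔ : I.rewardGap = Δ)
    (hε : I.effectGap = ε)
    (hobs : I.obsProb = M.prob none) (hD : IsRootedAt M.graph root depth)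
    (hM : M.HasBoundedMeansAndSubgaussianNoise) (hE : M.CausalEffectIdentifiable ε)
    (hR : M.RewardIdentifiable Δ) (hrule : IsCentralNodeRule (skeleton M.graph) I.central)
    (hK : 0 < K) (hTI : I.horizon = T)
    (hL : Real.log (((K : ℝ) * I.horizon) ^ 2 / I.failProb) = L)
    (hG : M.IsGoodSample Δ ε I.batch T L Z) {i : ℕ} (hi : Fintype.card V < 2 ^ i)
    (hiT : i ≤ I.horizon) :
    M.regret T (run Z T (fun _ => 0) I.cnUCB) ≤
      (I.batch + (i * (K * I.batch) +
        i * ((1 + maxDeg (skeleton M.graph)) * (K * I.batch))) : ℕ) +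
      Real.sqrt (K * T) * (1 + 6 * Real.sqrt (2 * L)) := by
  obtain ⟨l, m, hex, hl, hm⟩ := exec_cnUCB hT hΔ hε hobs hD hM hE hR hrule hG hi hiT
  have : Nonempty (Fin K) := ⟨⟨0, hK⟩⟩
  obtain ⟨k₀, hk₀⟩ := hM.exists_optimal
  rw [hL, hTI] at hex
  -- Every arm has been played `I.batch * m M.rewardNode` times before, with `m M.rewardNode ≤ 3`,
  -- so one of the four offsets in `arms` applies.
  obtain ⟨hlen, N, hN, hreg⟩ := exec_ucb (Z := Z) (μ := M.meanReward) M.rewardNode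
    (o := fun _ => I.batch * m M.rewardNode) (hG.arms (m M.rewardNode) (by omega)) (k₀ := k₀)
    (fun k => by
      have := hM.meanReward_nonneg (some (M.rewardNode, k))
      have := hM.optimalReward_le_one
      linarith)
    T (fun _ => 0) (fun _ => 0) (batchCounts I.batch I.batch m) (by simp)
    (fun k => by simp [batchCounts]) (by simp)
  rw [hk₀] at hreg
  set u := (exec Z (batchCounts I.batch I.batch m) (ucb M.rewardNode L T
    (fun _ => 0) (fun _ => 0))).1
  -- UCB alone would fill `T` rounds, so the truncated run has length exactly `T`; dropping the
  -- surplus rounds only lowers the sum, as all gaps are nonnegative.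
  rw [run_eq_take_exec, hex, hM.regret_le T (by simp [hlen]), List.take_append, List.map_append,
    List.sum_append]
  refine add_le_add ?_ ?_
  · refine (hM.sum_gap_le_length _).trans ?_
    exact_mod_cast (List.length_take_le' _ _).trans hl
  · refine (hM.sum_gap_take_le _ _).trans ?_
    have h1 : ∑ k, ∑ i ∈ range (N k), playCost L i ≤
        ∑ k, Real.sqrt (N k) * (1 + 6 * Real.sqrt (2 * L)) :=
      sum_le_sum fun k _ => sum_range_playCost_le (N k)
    rw [← sum_mul] at h1
    have h2 := mul_le_mul_of_nonneg_right (sum_sqrt_le T (by simpa using hN))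
      (by positivity : (0 : ℝ) ≤ 1 + 6 * Real.sqrt (2 * L))
    simp only [range_zero, sum_empty, sum_const_zero, add_zero] at hreg
    linarith

end LearnerInput

theorem CausalBandit.HasBoundedMeansAndSubgaussianNoise.regret_le_horizon {V : Type} [Fintype V]
    [DecidableEq V] {K : ℕ} {M : CausalBandit V K}
    [hP : ∀ a, IsProbabilityMeasure (M.outcomeLaw a)]
    (hM : M.HasBoundedMeansAndSubgaussianNoise) (T : ℕ) (l : List (Intervention V K)) :
    M.regret T l ≤ T := by
  have h1 : 0 ≤ (l.map M.meanReward).sum := by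
    refine List.sum_nonneg fun x hx => ?_
    obtain ⟨a, -, rfl⟩ := List.mem_map.1 hx
    exact hM.meanReward_nonneg a
  have h2 := mul_le_mul_of_nonneg_left hM.optimalReward_le_one (Nat.cast_nonneg (α := ℝ) T)
  rw [regret]
  linarith

theorem IsDirectedTree.one_le_maxDeg {n : ℕ} {D : Digraph (Fin n)} (h : IsDirectedTree D)
    (hn : 2 ≤ n) : 1 ≤ maxDeg (skeleton D) := by
  classical
  have : Nontrivial (Fin n) := Fin.nontrivial_iff_two_le.2 hn
  obtain ⟨v⟩ := h.1.1.nonempty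
  exact (h.1.1.preconnected.degree_pos_of_nontrivial v).trans_le
    (SimpleGraph.degree_le_maxDegree _ v)

/-! ### Estimates of the regret bound -/

section Estimates

theorem natLog_add_one_le {n : ℕ} (hn : 2 ≤ n) :
    ((Nat.log 2 n + 1 : ℕ) : ℝ) ≤ 3 * Real.log n := by
  have hn0 : (2 : ℝ) ≤ n := by exact_mod_cast hn
  have h2 := Real.log_two_gt_d9
  have h3 : Real.log 2 ≤ Real.log n := Real.log_le_log (by norm_num) hn0
  have h4 : (Nat.log 2 n : ℝ) * Real.log 2 ≤ Real.log n := by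
    rw [← Real.log_pow]
    refine Real.log_le_log (by positivity) ?_
    exact_mod_cast Nat.pow_log_le_self 2 (by omega)
  push_cast
  nlinarith

/-- As both logarithms on the right are at least `log 2`, the logarithms in the batch size are at
most 11 times their product. The constant is `32 * 11`, plus 3 for the rounding. -/
theorem batchSize_le {n K : ℕ} {Δ ε δ : ℝ} (hn : 2 ≤ n) (hK : 2 ≤ K) (hΔ : 0 < Δ) (hΔ1 : Δ ≤ 1)
    (hδ : 0 < δ) (hδ1 : δ < 1) :
    (batchSize n K Δ ε δ : ℝ) ≤
      355 * max (1 / Δ ^ 2) (1 / ε ^ 2) * Real.log n * Real.log (K / δ) := by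
  have hn0 : (2 : ℝ) ≤ n := by exact_mod_cast hn
  have hK0 : (2 : ℝ) ≤ K := by exact_mod_cast hK
  have h2 := Real.log_two_gt_d9
  have h2' := Real.log_two_lt_d9
  set m := max (1 / Δ ^ 2) (1 / ε ^ 2) with hm
  set a := Real.log n with ha
  set b := Real.log (K / δ) with hb
  have ha2 : Real.log 2 ≤ a := Real.log_le_log (by norm_num) hn0
  have hbeq : b = Real.log K - Real.log δ := Real.log_div (by positivity) hδ.ne'
  have hδlog : Real.log δ ≤ 0 := Real.log_nonpos hδ.le hδ1.le
  have hKlog : Real.log 2 ≤ Real.log K := Real.log_le_log (by norm_num) hK0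
  have hm1 : 1 ≤ m := by
    refine le_max_of_le_left ?_
    rw [le_div_iff₀ (by positivity), one_mul]
    exact pow_le_one₀ hΔ.le hΔ1
  have hlog8 : Real.log 8 = 3 * Real.log 2 := by
    rw [show (8 : ℝ) = 2 ^ 3 by norm_num, Real.log_pow]
    norm_num
  have hab : 0.69 * 0.69 ≤ a * b :=
    mul_le_mul (by linarith) (by linarith) (by norm_num) (by linarith)
  have hA : Real.log (8 * (n : ℝ) ^ 2 * (K : ℝ) ^ 2 / δ) ≤ 11 * (a * b) := by
    rw [Real.log_div (by positivity) hδ.ne', Real.log_mul (by positivity) (by positivity),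
      Real.log_mul (by norm_num) (by positivity), Real.log_pow, Real.log_pow, hlog8]
    push_cast
    nlinarith
  have hA0 : 0 ≤ Real.log (8 * (n : ℝ) ^ 2 * (K : ℝ) ^ 2 / δ) := by
    refine Real.log_nonneg ?_
    rw [le_div_iff₀ hδ]
    have h3 : 1 ≤ (n : ℝ) ^ 2 := one_le_pow₀ (by linarith)
    have h4 : 1 ≤ (K : ℝ) ^ 2 := one_le_pow₀ (by linarith)
    nlinarith [one_le_mul_of_one_le_of_one_le h3 h4]
  have hA' : Real.log (8 * n * K / δ) ≤ Real.log (8 * (n : ℝ) ^ 2 * (K : ℝ) ^ 2 / δ) := by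
    refine Real.log_le_log (by positivity) (div_le_div_of_nonneg_right ?_ hδ.le)
    have h3 : (n : ℝ) ≤ (n : ℝ) ^ 2 := by nlinarith
    have h4 : (K : ℝ) ≤ (K : ℝ) ^ 2 := by nlinarith
    gcongr
  have h5 : max (32 / Δ ^ 2 * Real.log (8 * n * K / δ))
      (2 / ε ^ 2 * Real.log (8 * (n : ℝ) ^ 2 * (K : ℝ) ^ 2 / δ)) ≤ 32 * m * (11 * (a * b)) := by
    refine max_le ?_ ?_
    · refine (mul_le_mul_of_nonneg_left (hA'.trans hA) (by positivity)).trans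
        (mul_le_mul_of_nonneg_right ?_ (by linarith))
      have := le_max_left (1 / Δ ^ 2) (1 / ε ^ 2)
      rw [show 32 / Δ ^ 2 = 32 * (1 / Δ ^ 2) by ring]
      linarith
    · refine (mul_le_mul_of_nonneg_left hA (by positivity)).trans
        (mul_le_mul_of_nonneg_right ?_ (by linarith))
      have := le_max_right (1 / Δ ^ 2) (1 / ε ^ 2)
      rw [show 2 / ε ^ 2 = 2 * (1 / ε ^ 2) by ring]
      linarith
  have h6 : (batchSize n K Δ ε δ : ℝ) ≤ 32 * m * (11 * (a * b)) + 1 := by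
    have h7 : 0 ≤ 32 * m * (11 * (a * b)) := by
      have : 0 ≤ a * b := by linarith
      positivity
    have h8 : (batchSize n K Δ ε δ : ℝ) ≤ (⌈32 * m * (11 * (a * b))⌉₊ : ℕ) :=
      Nat.cast_le.2 (Nat.ceil_mono h5)
    exact h8.trans (Nat.ceil_lt_add_one h7).le
  have h9 : a * b ≤ m * (a * b) := le_mul_of_one_le_left (by linarith) hm1
  linarith

/-- The three summands are at most 1.5, 3 and 6 times `a * (K * d * B)`, and `10.5 * 355 ≤ 4000`. -/
theorem exploration_le {B i K d a m b : ℝ} (hB : B ≤ 355 * m * a * b) (hB0 : 0 ≤ B)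
    (hi : i ≤ 3 * a) (ha : 0.69 ≤ a) (hK : 1 ≤ K) (hd : 1 ≤ d) :
    B + (i * (K * B) + i * ((1 + d) * (K * B))) ≤ 4000 * (K * m * d * a ^ 2 * b) := by
  have hKd : 1 ≤ K * d := one_le_mul_of_one_le_of_one_le hK hd
  have hKB : 0 ≤ K * B := by positivity
  have h1 : B ≤ 1.5 * a * (K * d * B) := by
    have : 1 ≤ 1.5 * a * (K * d) :=
      one_le_mul_of_one_le_of_one_le (by linarith) hKd
    calc B ≤ 1.5 * a * (K * d) * B := le_mul_of_one_le_left hB0 this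
      _ = _ := by ring
  have h2 : i * (K * B) ≤ 3 * a * (K * d * B) := by
    refine mul_le_mul hi ?_ hKB (by linarith)
    have := le_mul_of_one_le_left hKB hd
    linarith
  have h3 : i * ((1 + d) * (K * B)) ≤ 3 * a * (2 * (K * d * B)) := by
    refine mul_le_mul hi ?_ (by positivity) (by linarith)
    have := le_mul_of_one_le_left hKB hd
    linarith
  have h4 : a * (K * d) * B ≤ a * (K * d) * (355 * m * a * b) :=
    mul_le_mul_of_nonneg_left hB (by positivity)
  have h5 : 0 ≤ a * (K * d) * (355 * m * a * b) := le_trans (by positivity) h4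
  linarith

theorem sqrt_mul_le {x δ : ℝ} (hx : 2 ≤ x) (hδ : 0 < δ) (hδ1 : δ < 1) :
    Real.sqrt x * (1 + 6 * Real.sqrt (2 * Real.log (x ^ 2 / δ))) ≤
      14 * Real.sqrt (x * Real.log (x / δ)) := by
  set w := Real.log (x / δ) with hw
  have h2 := Real.log_two_gt_d9
  have hδlog : Real.log δ ≤ 0 := Real.log_nonpos hδ.le hδ1.le
  have hlog : Real.log 2 ≤ Real.log x := Real.log_le_log (by norm_num) hx
  have hweq : w = Real.log x - Real.log δ := Real.log_div (by linarith) hδ.ne'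
  have hL : Real.log (x ^ 2 / δ) ≤ 2 * w := by
    rw [Real.log_div (by positivity) hδ.ne', Real.log_pow]
    push_cast
    linarith
  have h3 : Real.sqrt (2 * Real.log (x ^ 2 / δ)) ≤ 2 * Real.sqrt w := by
    rw [Real.sqrt_le_left (by positivity), mul_pow, Real.sq_sqrt (by linarith)]
    linarith
  have h4 : 1 ≤ 2 * Real.sqrt w := by
    have : 1 / 2 ≤ Real.sqrt w := Real.le_sqrt_of_sq_le (by linarith)
    linarith
  rw [Real.sqrt_mul (by linarith : 0 ≤ x) w]
  have := mul_le_mul_of_nonneg_left (by linarith :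
    1 + 6 * Real.sqrt (2 * Real.log (x ^ 2 / δ)) ≤ 14 * Real.sqrt w)
    (Real.sqrt_nonneg x)
  linarith

/-- Covers the horizons too short for the union bound over the arms: here `T < 64`, while the root
is at least one. -/
theorem horizon_le_sqrt {K T : ℕ} {δ : ℝ} (hK : 2 ≤ K) (hT : 1 ≤ T) (hKT : K * T < 128)
    (hδ : 0 < δ) (hδ1 : δ < 1) :
    (T : ℝ) ≤ 4000 * Real.sqrt (K * T * Real.log (K * T / δ)) := by
  have hK0 : (2 : ℝ) ≤ K := by exact_mod_cast hK
  have hT0 : (1 : ℝ) ≤ T := by exact_mod_cast hT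
  have hKT0 : (K : ℝ) * T < 128 := by exact_mod_cast hKT
  have h2 := Real.log_two_gt_d9
  have hw : Real.log 2 ≤ Real.log (K * T / δ) := by
    refine Real.log_le_log (by norm_num) ?_
    rw [le_div_iff₀ hδ]
    nlinarith
  have h3 : 1 ≤ Real.sqrt (K * T * Real.log (K * T / δ)) := by
    rw [Real.one_le_sqrt]
    have : 2 * 0.69 ≤ K * T * Real.log (K * T / δ) :=
      mul_le_mul (by nlinarith) (by linarith) (by norm_num) (by positivity)
    linarith
  nlinarith

end Estimates

/-! ### The main theorem. -/

theorem theorem1 :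
    ∃ c : ℝ, 0 < c ∧
      ∀ (n K T : ℕ) (Δ ε δ : ℝ) (M : CausalBandit (Fin n) K)
        (rule : Finset (Fin n) → (Fin n → ℝ) → Fin n)
        (Ω : Type*) [MeasurableSpace Ω] (P : Measure Ω) [IsProbabilityMeasure P]
        (Z : Intervention (Fin n) K → ℕ → Ω → Outcome (Fin n) K),
        2 ≤ n → 1 ≤ T → 0 < Δ → 0 < ε → 0 < δ → δ < 1 →
        IsDirectedTree M.graph →
        M.HasBoundedMeansAndSubgaussianNoise →
        M.CausalEffectIdentifiable ε →
        M.RewardIdentifiable Δ →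
        IsCentralNodeRule (skeleton M.graph) rule →
        -- `Z a i` is the outcome of the `i`-th play of the action `a`
        (∀ a i, HasLaw (Z a i) (M.outcomeLaw a) P) →
        iIndepFun (fun p : Intervention (Fin n) K × ℕ => Z p.1 p.2) P →
        P {ω | ¬ M.regret T
              (Strategy.run (fun a i => Z a i ω) T (fun _ => 0)
                (LearnerInput.cnUCB
                  { tree := skeleton M.graph
                    obsProb := M.prob none
                    rewardGap := Δ
                    effectGap := ε
                    batch := batchSize n K Δ ε δ
                    failProb := δ
                    horizon := T
                    central := rule })) ≤
            c * (K * max (1 / Δ ^ 2) (1 / ε ^ 2) * maxDeg (skeleton M.graph) * Real.log n ^ 2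
                  * Real.log (K / δ)
                + Real.sqrt (K * T * Real.log (K * T / δ)))}
          ≤ ENNReal.ofReal δ := by
  refine ⟨4000, by norm_num, ?_⟩
  intro n K T Δ ε δ M rule Ω _ P _ Z hn hT hΔ hε hδ hδ1 hD hM hE hR hrule hZ hind
  -- Total mass one need not be derived from the factorization, since the law is that of the random
  -- variable `Z a 0`.
  have hP : ∀ a, IsProbabilityMeasure (M.outcomeLaw a) := fun a => by
    rw [← (hZ a 0).map_eq]
    exact Measure.isProbabilityMeasure_map (hZ a 0).aemeasurable
  have hK : 2 ≤ K := hM.two_le_card hΔ hR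
  have hΔ1 : Δ ≤ 1 := hM.gap_le_one hR
  have hd : 1 ≤ maxDeg (skeleton M.graph) := hD.one_le_maxDeg hn
  have hK0 : (2 : ℝ) ≤ K := by exact_mod_cast hK
  have hn0 : (2 : ℝ) ≤ n := by exact_mod_cast hn
  have hT0 : (1 : ℝ) ≤ T := by exact_mod_cast hT
  have hd0 : (1 : ℝ) ≤ maxDeg (skeleton M.graph) := by exact_mod_cast hd
  have hlog2 := Real.log_two_gt_d9
  have ha : 0.69 ≤ Real.log n := by
    have := Real.log_le_log (by norm_num) hn0
    linarith
  have hb : 0.69 ≤ Real.log (K / δ) := by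
    have : Real.log 2 ≤ Real.log (K / δ) := by
      refine Real.log_le_log (by norm_num) ?_
      rw [le_div_iff₀ hδ]
      nlinarith
    linarith
  have hm : 1 ≤ max (1 / Δ ^ 2) (1 / ε ^ 2) := by
    refine le_max_of_le_left ?_
    rw [le_div_iff₀ (by positivity), one_mul]
    exact pow_le_one₀ hΔ.le hΔ1
  have hlog := natLog_add_one_le hn
  have hexpl0 : 0 ≤ K * max (1 / Δ ^ 2) (1 / ε ^ 2) * maxDeg (skeleton M.graph) * Real.log n ^ 2
      * Real.log (K / δ) := by
    have : 0 ≤ Real.log (K / δ) := by linarith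
    positivity
  have htrivial : ∀ {b : ℝ}, (T : ℝ) ≤ b → ∀ f : Ω → List (Intervention (Fin n) K),
      P {ω | ¬ M.regret T (f ω) ≤ b} ≤ ENNReal.ofReal δ := by
    intro b hb f
    have hempty : {ω | ¬ M.regret T (f ω) ≤ b} = ∅ :=
      Set.eq_empty_of_forall_notMem fun ω hω => hω ((hM.regret_le_horizon T (f ω)).trans hb)
    rw [hempty, measure_empty]
    exact zero_le
  by_cases hKT : 128 ≤ K * T
  swap
  · have h1 := horizon_le_sqrt hK hT (by omega) hδ hδ1
    exact htrivial (by linarith) _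
  -- The search stages have fuel `T`, which must cover the number of halvings. Otherwise `T ≤ 3 *
  -- log n`, and the exploration term alone exceeds the trivial bound.
  by_cases hTlog : Nat.log 2 n + 1 ≤ T
  swap
  · have h1 : (T : ℝ) ≤ 3 * Real.log n := by
      have : (T : ℝ) ≤ (Nat.log 2 n + 1 : ℕ) := by exact_mod_cast (by omega)
      linarith
    have h2 := exploration_le (B := 355 * max (1 / Δ ^ 2) (1 / ε ^ 2) * Real.log n *
      Real.log (K / δ)) le_rfl (by positivity) le_rfl ha (by linarith : (1 : ℝ) ≤ K) hd0
    have h3 : 355 * (0.69 * 0.69) ≤ 355 * max (1 / Δ ^ 2) (1 / ε ^ 2) * Real.log n *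
        Real.log (K / δ) := by
      have h4 : 0.69 * 0.69 ≤ Real.log n * Real.log (K / δ) :=
        mul_le_mul ha hb (by norm_num) (by linarith)
      have h5 := mul_le_mul hm h4 (by norm_num) (by linarith)
      linarith
    have h6 : 1 ≤ K * (355 * max (1 / Δ ^ 2) (1 / ε ^ 2) * Real.log n * Real.log (K / δ)) := by
      nlinarith
    have h7 := Real.sqrt_nonneg (K * T * Real.log (K * T / δ))
    exact htrivial (by nlinarith) _
  refine (measure_mono ?_).trans
    (measure_not_isGoodSample_le hn hK hKT hΔ hε hδ hδ1 hD hM hZ hind)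
  intro ω hω hG
  obtain ⟨root, depth, hroot⟩ := hD.exists_isRootedAt
  refine hω ((LearnerInput.regret_le_of_isGoodSample (T := T)
    (I := ⟨skeleton M.graph, M.prob none, Δ, ε, batchSize n K Δ ε δ, δ, T, rule⟩)
    (Z := fun a i => Z a i ω) rfl rfl rfl rfl hroot hM hE hR hrule
    (by omega) rfl rfl hG (i := Nat.log 2 n + 1)
    (by rw [Fintype.card_fin]; exact Nat.lt_pow_succ_log_self (by norm_num) n) hTlog).trans ?_)
  have h1 := exploration_le (batchSize_le (ε := ε) hn hK hΔ hΔ1 hδ hδ1) (Nat.cast_nonneg _) hlog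
    ha (by linarith : (1 : ℝ) ≤ K) hd0
  have h2 := sqrt_mul_le (x := K * T) (by nlinarith) hδ hδ1
  have h3 := Real.sqrt_nonneg (K * T * Real.log (K * T / δ))
  push_cast at h1 ⊢
  linarith
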